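/- **Proposition (Basic Identity for nondegenerate maps).** Conventions. For $N\in\mathbb N$ let $\mathbb C[\![Z,\zeta]\!]$ be the ring of formal power series in $Z=(Z_1,\dots,Z_N)$, $\zeta=(\zeta_1,\dots,\zeta_N)$; a bar over a series denotes conjugation of its coefficients. A *formal generic submanifold* $M\subset\mathbb C^N$ (through $0$) of codimension $d$ is an ideal $I\subset\mathbb C[\![Z,\zeta]\!]$ generated by $d$ series $\rho_1,\dots,\rho_d$ with $\rho_j(0)=0$ and $\bar\rho_j(\zeta,Z)\in I$ for all $j$, whose complex gradients $\rho_{j,Z}(0)=(\partial\rho_j/\partial Z_1,\dots,\partial\rho_j/\partial Z_N)(0)$, $1\le j\le d$, are linearly independent. $M$ is *real-analytic* (resp. *algebraic*) if $I$ has $d$ generators that converge near $0$ (resp. that converge near $0$ and are algebraic over the polynomials). A *formal map* $H:M\to M'$, where $M'\subset\mathbb C^{N'}$ has codimension $d'$ and ideal $I'$, is an $N'$-tuple $H\in\mathbb C[\![Z]\!]^{N'}$ with $H(0)=0$ and $f(H(Z),\bar H(\zeta))\in I$ for all $f\in I'$. A *formal CR-vector field* tangent to $M$ is an operator $L=\sum_j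 b_j(Z,\zeta)\,\partial/\partial\zeta_j$ with $L(I)\subset I$. Given generators $\rho'_1,\dots,\rho'_{d'}$ of $I'$, let $E_k\subset\mathbb C[\![Z,\zeta]\!]^{N'}$ be the $\mathbb C[\![Z,\zeta]\!]$-submodule spanned by all vectors $L_1\cdots L_r\,\rho'_{j,Z'}(H(Z),\bar H(\zeta))$ with $0\le r\le k$, $1\le j\le d'$ and $L_1,\dots,L_r$ formal CR-vector fields tangent to $M$, and let $E_k(0)\subset\mathbb C^{N'}$ be the space of its values at $0$ (which does not depend on the generators). $H$ is *$k_0$-nondegenerate* if $k_0$ is the least $k$ with $E_m(0)=E_k(0)$ for all $m\ge k$, and $E_{k_0}(0)=\mathbb C^{N'}$. Finally $\partial^\beta$ is the partial derivative with multiindex $\beta\in\mathbb N^N$, and $K(k_0)$ is the number of $\beta\in\mathbb N^N$ with $|\beta|\le k_0$. Statement. Let $M\subset\mathbb C^N$, $M'\subset\mathbb C^{N'}$ be formal generic submanifolds, $I$ the ideal of $M$, and $H:M\to M'$ a $k_0$-nondegenerate formal map. Then there is a formal map $\Psi\in\mathbb C[\![Z,\zeta,W]\!]^{N'}$, $W\in\mathbb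 C^{K(k_0)N'}$, depending only on $M$, $M'$, $k_0$ and the values $\partial^\beta H(0)$, $|\beta|\le k_0$, such that $$H(Z)-\Psi\bigl(Z,\zeta,(\partial^\beta\bar H(\zeta)-\partial^\beta\bar H(0))_{0\le|\beta|\le k_0}\bigr)\in I^{N'}. \qquad (*)$$ In particular, if $H':M\to M'$ is another formal map with $\partial^\beta H'(0)=\partial^\beta H(0)$ for $|\beta|\le k_0$, then $(*)$ holds with the same $\Psi$ and with $H'$ in place of $H$. If $M$ and $M'$ are real-analytic, $\Psi$ converges on a neighbourhood of the origin. If $M$ and $M'$ are algebraic, so is $\Psi$ (each component converges near $0$ and is algebraic over the polynomials in $(Z,\zeta,W)$). -/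

import Mathlib

noncomputable section

namespace FormalCR

open MvPowerSeries

/-- The ring `ℂ⟦Z, ζ⟧` of formal power series in the `2N` variables `Z = (Z_1, …, Z_N)`
(indices `Sum.inl i`) and `ζ = (ζ_1, …, ζ_N)` (indices `Sum.inr i`). -/
abbrev BiSeries (N : ℕ) : Type := MvPowerSeries (Fin N ⊕ Fin N) ℂ

/-- The power series with complex conjugated coefficients. -/
def bar {σ : Type*} : MvPowerSeries σ ℂ →+* MvPowerSeries σ ℂ :=
  MvPowerSeries.map (starRingEnd ℂ)

/-- A series `f(Z)` regarded as an element of `ℂ⟦Z, ζ⟧`. -/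
def inZ {N : ℕ} (f : MvPowerSeries (Fin N) ℂ) : BiSeries N := rename Sum.inl f

/-- The series `f(ζ) ∈ ℂ⟦Z, ζ⟧`, for a series `f` in `N` variables. -/
def inZeta {N : ℕ} (f : MvPowerSeries (Fin N) ℂ) : BiSeries N := rename Sum.inr f

/-- The series `ρ̄(ζ, Z)`: conjugate the coefficients of `ρ(Z, ζ)` and exchange `Z` and `ζ`. -/
def conjSwap {N : ℕ} (ρ : BiSeries N) : BiSeries N := rename Sum.swap (bar ρ)

/-- The complex gradient `ρ_Z = (∂ρ/∂Z_1, …, ∂ρ/∂Z_N)`. -/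
def gradZ {N : ℕ} (ρ : BiSeries N) : Fin N → BiSeries N :=
  fun i => pderiv ℂ (Sum.inl i) ρ

/-- The value at the origin of a vector of formal power series, as a linear map. -/
def evalZero {σ : Type*} (m : ℕ) : (Fin m → MvPowerSeries σ ℂ) →ₗ[ℂ] (Fin m → ℂ) :=
  (MvPowerSeries.coeff (0 : σ →₀ ℕ)).compLeft (Fin m)

/-- A formal generic submanifold of `ℂ^N` (through the origin) of codimension `d`: an ideal of
`ℂ⟦Z, ζ⟧` that is generated by `d` series `ρ_1, …, ρ_d` without constant term such that each
`ρ̄_j(ζ, Z)` lies in the ideal and the gradients `ρ_{1,Z}(0), …, ρ_{d,Z}(0)` are linearly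
independent. -/
structure FormalGenericSubmanifold (N d : ℕ) where
  /-- The ideal `I` that represents the submanifold. -/
  ideal : Ideal (BiSeries N)
  exists_generators : ∃ ρ : Fin d → BiSeries N,
    Ideal.span (Set.range ρ) = ideal ∧
    (∀ j, constantCoeff (ρ j) = 0) ∧
    (∀ j, conjSwap (ρ j) ∈ ideal) ∧
    LinearIndependent ℂ (fun j => evalZero N (gradZ (ρ j)))

/-- `ρ = (ρ_1, …, ρ_d)` is a set of `d` generators of the ideal of `M`. -/
def FormalGenericSubmanifold.IsGenerators {N d : ℕ} (M : FormalGenericSubmanifold N d)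
    (ρ : Fin d → BiSeries N) : Prop :=
  Ideal.span (Set.range ρ) = M.ideal

/-- A formal holomorphic map `H : (ℂ^N, 0) → (ℂ^N', 0)`: an `N'`-tuple of formal power series
in `Z` without constant term. -/
structure FormalMap (N N' : ℕ) where
  /-- The components `H_1, …, H_{N'}`. -/
  comp : Fin N' → MvPowerSeries (Fin N) ℂ
  map_zero : ∀ j, constantCoeff (comp j) = 0

/-- The tuple `(H(Z), H̄(ζ))` that is substituted for `(Z', ζ')`. -/
def FormalMap.pair {N N' : ℕ} (H : FormalMap N N') : Fin N' ⊕ Fin N' → BiSeries N :=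
  Sum.elim (fun j => inZ (H.comp j)) (fun j => inZeta (bar (H.comp j)))

/-- The ring homomorphism `H^♯ f = f(H(Z), H̄(ζ))`. -/
def FormalMap.pullback {N N' : ℕ} (H : FormalMap N N') (f : BiSeries N') : BiSeries N :=
  f.subst H.pair

/-- The substitution defining `H^♯` is legitimate. -/
theorem FormalMap.hasSubst_pair {N N' : ℕ} (H : FormalMap N N') : HasSubst H.pair := by
  apply hasSubst_of_constantCoeff_zero
  rintro (j | j)
  · simp [pair, inZ, H.map_zero]
  · simp [pair, inZeta, bar, H.map_zero]

/-- `H` maps `M` into `M'`, that is, `H^♯(I') ⊆ I`. -/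
def FormalMap.MapsInto {N N' d d' : ℕ} (H : FormalMap N N')
    (M : FormalGenericSubmanifold N d) (M' : FormalGenericSubmanifold N' d') : Prop :=
  ∀ f ∈ M'.ideal, H.pullback f ∈ M.ideal

/-- The formal vector field `∑ b_j(Z, ζ) ∂/∂ζ_j` of type `(0,1)`, acting on a series. -/
def vf01 {N : ℕ} (b : Fin N → BiSeries N) (f : BiSeries N) : BiSeries N :=
  ∑ j, b j * pderiv ℂ (Sum.inr j) f

/-- The `(0,1)` vector field with coefficients `b` is a formal CR-vector field tangent to `M`. -/
def FormalGenericSubmanifold.IsCRVectorField {N d : ℕ} (M : FormalGenericSubmanifold N d)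
    (b : Fin N → BiSeries N) : Prop :=
  ∀ f ∈ M.ideal, vf01 b f ∈ M.ideal

/-- The iterated derivative `L_1 ⋯ L_r f` along a list of `(0,1)` vector fields. -/
def vf01List {N : ℕ} (Ls : List (Fin N → BiSeries N)) (f : BiSeries N) : BiSeries N :=
  Ls.foldr vf01 f

/-- The submodule `E_k` of `ℂ⟦Z, ζ⟧^N'` spanned by all vectors
`L_1 ⋯ L_r ρ'_{j,Z'}(H(Z), H̄(ζ))` with `L_1, …, L_r` formal CR-vector fields tangent to `M`,
`0 ≤ r ≤ k`, and `1 ≤ j ≤ d'`. -/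
def degSubmodule {N N' d d' : ℕ} (M : FormalGenericSubmanifold N d) (H : FormalMap N N')
    (ρ' : Fin d' → BiSeries N') (k : ℕ) : Submodule (BiSeries N) (Fin N' → BiSeries N) :=
  Submodule.span (BiSeries N)
    {v | ∃ Ls : List (Fin N → BiSeries N), (∀ L ∈ Ls, M.IsCRVectorField L) ∧ Ls.length ≤ k ∧
      ∃ j, v = fun i => vf01List Ls (H.pullback (gradZ (ρ' j) i))}

/-- The subspace `E_k(0)` of `ℂ^N'`. -/
def degSpace {N N' d d' : ℕ} (M : FormalGenericSubmanifold N d) (H : FormalMap N N')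
    (ρ' : Fin d' → BiSeries N') (k : ℕ) : Submodule ℂ (Fin N' → ℂ) :=
  ((degSubmodule M H ρ' k).restrictScalars ℂ).map (evalZero N')

/-- `H : M → M'` is `(k₀, s)`-degenerate at the origin: `k₀` is the index at which the chain
`E_k(0)` stabilizes, and `s = N' - dim E_{k₀}(0)`. The spaces `E_k(0)` do not depend on the
generators of the ideal of `M'`, so it does not matter for which generators this is required. -/
def FormalMap.IsDegenerate {N N' d d' : ℕ} (H : FormalMap N N')
    (M : FormalGenericSubmanifold N d) (M' : FormalGenericSubmanifold N' d') (k₀ s : ℕ) : Prop :=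
  ∃ ρ' : Fin d' → BiSeries N', M'.IsGenerators ρ' ∧
    IsLeast {k | ∀ m, k ≤ m → degSpace M H ρ' m = degSpace M H ρ' k} k₀ ∧
    Module.finrank ℂ (degSpace M H ρ' k₀) + s = N'

/-- `H : M → M'` is `k₀`-nondegenerate at the origin. -/
def FormalMap.IsNondegenerate {N N' d d' : ℕ} (H : FormalMap N N')
    (M : FormalGenericSubmanifold N d) (M' : FormalGenericSubmanifold N' d') (k₀ : ℕ) : Prop :=
  H.IsDegenerate M M' k₀ 0

/-- A formal power series converges (absolutely) on a neighbourhood of the origin. -/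
def IsConvergent {σ : Type*} (f : MvPowerSeries σ ℂ) : Prop :=
  ∃ r : ℝ, 0 < r ∧ Summable fun n : σ →₀ ℕ => ‖coeff n f‖ * r ^ n.degree

/-- A formal power series is (the germ at the origin of) an algebraic function: it converges and
satisfies a nontrivial polynomial equation with coefficients polynomials in the variables. -/
def IsAlgebraicSeries {σ : Type*} (f : MvPowerSeries σ ℂ) : Prop :=
  IsConvergent f ∧ IsAlgebraic (MvPolynomial σ ℂ) f

/-- `M` is real-analytic: it has convergent defining functions. -/
def FormalGenericSubmanifold.IsRealAnalytic {N d : ℕ}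
    (M : FormalGenericSubmanifold N d) : Prop :=
  ∃ ρ : Fin d → BiSeries N, M.IsGenerators ρ ∧ ∀ j, IsConvergent (ρ j)

/-- `M` is algebraic: it has algebraic defining functions. -/
def FormalGenericSubmanifold.IsAlgebraicSubmanifold {N d : ℕ}
    (M : FormalGenericSubmanifold N d) : Prop :=
  ∃ ρ : Fin d → BiSeries N, M.IsGenerators ρ ∧ ∀ j, IsAlgebraicSeries (ρ j)

/-- The derivative `∂^β = ∂_1^{β_1} ⋯ ∂_N^{β_N}` of a formal power series. -/
def multiDeriv {N : ℕ} (β : Fin N →₀ ℕ) (f : MvPowerSeries (Fin N) ℂ) :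
    MvPowerSeries (Fin N) ℂ :=
  (List.finRange N).foldr (fun i g => (pderiv ℂ i)^[β i] g) f

/-- The multiindices `β ∈ ℕ^N` with `|β| ≤ k`; there are `K(k)` of them. -/
abbrev MultiIdx (N k : ℕ) : Type := {β : Fin N →₀ ℕ // β.degree ≤ k}

instance (N k : ℕ) : Finite (MultiIdx N k) := by
  refine ((Set.finite_Iic (Finsupp.equivFunOnFinite.symm
    (fun _ : Fin N => k) : Fin N →₀ ℕ)).subset ?_).to_subtype
  intro β hβ i
  exact (Finsupp.le_degree i β).trans hβ

/-- The `k`-jet `(∂^β H(0))_{|β| ≤ k}` of `H` at the origin. -/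
def FormalMap.jet {N N' : ℕ} (k : ℕ) (H : FormalMap N N') : MultiIdx N k × Fin N' → ℂ :=
  fun p => constantCoeff (multiDeriv p.1.1 (H.comp p.2))

/-- Indices of the variables `(Z, ζ, W) ∈ ℂ^N × ℂ^N × ℂ^{K(k) N'}`. -/
abbrev JetVars (N N' k : ℕ) : Type := (Fin N ⊕ Fin N) ⊕ (MultiIdx N k × Fin N')

/-- The tuple `(Z, ζ, (∂^β H̄(ζ) - ∂^β H̄(0))_{|β| ≤ k})` that is substituted for `(Z, ζ, W)`. -/
def FormalMap.jetTuple {N N' : ℕ} (k : ℕ) (H : FormalMap N N') : JetVars N N' k → BiSeries N :=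
  Sum.elim MvPowerSeries.X
    (fun p => inZeta (multiDeriv p.1.1 (bar (H.comp p.2))) -
      C (constantCoeff (multiDeriv p.1.1 (bar (H.comp p.2)))))

/-- The substitution of this tuple is legitimate. -/
theorem FormalMap.hasSubst_jetTuple {N N' : ℕ} (k : ℕ) (H : FormalMap N N') :
    HasSubst (H.jetTuple k) := by
  apply hasSubst_of_constantCoeff_zero
  rintro (j | j)
  · simp [jetTuple]
  · simp [jetTuple, inZeta]

/-- The identity `H(Z) - Ψ(Z, ζ, (∂^β H̄(ζ) - ∂^β H̄(0))_{|β| ≤ k}) ∈ I^N'`. -/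
def BasicIdentity {N N' d : ℕ} (M : FormalGenericSubmanifold N d) (k : ℕ)
    (Ψ : Fin N' → MvPowerSeries (JetVars N N' k) ℂ) (H : FormalMap N N') : Prop :=
  ∀ j, inZ (H.comp j) - (Ψ j).subst (H.jetTuple k) ∈ M.ideal

end FormalCR

end

/-! The identity comes from differentiating the defining equations of `M'` along `M` and solving the
resulting system for `H(Z)`. If `ρ'` is in the ideal of `M'`, then `ρ'(H(Z), H̄(ζ))` and all its
derivatives along CR-vector fields lie in `I`. These fields differentiate in `ζ` only, so an
`r`-fold derivative is a fixed series `Φ(Z, ζ, W, Z')` evaluated at `Z' = H(Z)` and `W` the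
normalised `r`-jet of `H̄(ζ)`; of `H` itself, `Φ` involves only the jet at the origin
(`exists_universal_vf01List`). CR-vector fields commute with `∂/∂Z'`, so the `Z'`-gradients of the
`Φ` at the origin are the vectors that span `E_k(0)`. Nondegeneracy thus yields `Φ_1, …, Φ_{N'}`
whose `Z'`-gradients at 0 form the standard basis (`equationGradients_eq_top`). The implicit
function theorem, in the fixed point form `Z' = Z' - Φ(Z, ζ, W, Z')`, defines `Ψ`. Since `H(Z)`
solves the system only modulo `I`, the congruence with `Ψ` needs Nakayama's lemma
(`sub_subst_fixedPoint_mem`). Regularity is treated once, for any `SeriesClass`: the CR-vector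
fields are replaced by a frame with coefficients in the class (`exists_frame`), and every step stays
in the class. What remains is the implicit function theorem for convergent series, by a weighted
norm estimate on the iterates, and for algebraic series, by counting transcendence degrees. -/

noncomputable section

/-! ### Chain rule and Hadamard's lemma for formal power series. -/

namespace MvPowerSeries

open Finsupp

section Calculus

variable {σ τ R : Type*} [CommRing R]

theorem subst_zero {a : σ → MvPowerSeries τ R} (ha : HasSubst a) :
    (0 : MvPowerSeries σ R).subst a = 0 := by
  rw [← coe_substAlgHom ha, map_zero]

theorem subst_one {a : σ → MvPowerSeries τ R} (ha : HasSubst a) :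
    (1 : MvPowerSeries σ R).subst a = 1 := by
  rw [← coe_substAlgHom ha, map_one]

theorem subst_sum {ι : Type*} {a : σ → MvPowerSeries τ R} (ha : HasSubst a) (s : Finset ι)
    (f : ι → MvPowerSeries σ R) : (∑ i ∈ s, f i).subst a = ∑ i ∈ s, (f i).subst a := by
  simp only [← coe_substAlgHom ha, map_sum]

theorem constantCoeff_subst_of_constantCoeff_zero {a : σ → MvPowerSeries τ R} (ha : HasSubst a)
    (ha' : ∀ i, constantCoeff (a i) = 0) (f : MvPowerSeries σ R) :
    constantCoeff (f.subst a) = constantCoeff f := by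
  have h := constantCoeff_subst_eq_zero ha ha' (f := f - C (constantCoeff f)) (by simp)
  rw [subst_sub ha, subst_C, map_sub, constantCoeff_C] at h
  exact sub_eq_zero.mp h

open scoped MvPowerSeries.WithPiTopology in
theorem continuous_pderiv [TopologicalSpace R] [IsTopologicalRing R] (i : σ) :
    Continuous (pderiv R i : MvPowerSeries σ R → MvPowerSeries σ R) := by
  refine continuous_pi fun n => ?_
  have : (fun f : MvPowerSeries σ R => pderiv R i f n) =
      fun f : MvPowerSeries σ R => coeff (n + single i 1) f * ((n i : R) + 1) := by
    funext f
    exact coeff_pderiv f n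
  rw [this]
  exact (WithPiTopology.continuous_coeff R _).mul continuous_const

open scoped MvPowerSeries.WithPiTopology in
/-- The chain rule for formal power series. -/
theorem pderiv_subst [Fintype σ] {a : σ → MvPowerSeries τ R} (ha : HasSubst a) (j : τ)
    (f : MvPowerSeries σ R) :
    pderiv R j (f.subst a) = ∑ i, (pderiv R i f).subst a * pderiv R j (a i) := by
  classical
  -- For discrete coefficients polynomials are dense in the coefficientwise topology and
  -- substitution is continuous, so polynomials suffice.
  let : UniformSpace R := ⊥
  have : DiscreteUniformity R := ⟨rfl⟩
  have key : ∀ p : MvPolynomial σ R, pderiv R j ((p : MvPowerSeries σ R).subst a) =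
      ∑ i, (pderiv R i (p : MvPowerSeries σ R)).subst a * pderiv R j (a i) := by
    intro p
    induction p using MvPolynomial.induction_on with
    | C r =>
      rw [MvPolynomial.coe_C, subst_C, pderiv_C]
      simp [subst_zero ha]
    | add p q hp hq =>
      simp only [MvPolynomial.coe_add, map_add, subst_add ha, hp, hq, add_mul,
        Finset.sum_add_distrib]
    | mul_X p i hp =>
      simp only [MvPolynomial.coe_mul, MvPolynomial.coe_X, Derivation.leibniz, subst_mul ha,
        subst_add ha, subst_X ha, smul_eq_mul, hp, add_mul, Finset.sum_add_distrib]
      congr 1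
      · rw [Finset.sum_eq_single i]
        · simp [subst_one ha]
        · intro b _ hb
          simp [pderiv_X_of_ne hb.symm, subst_zero ha]
        · simp
      · rw [Finset.mul_sum]
        exact Finset.sum_congr rfl fun _ _ => by ring
  refine congr_fun ((WithPiTopology.denseRange_toMvPowerSeries (σ := σ) (R := R)).equalizer
    (g := fun f : MvPowerSeries σ R => pderiv R j (f.subst a))
    (h := fun f : MvPowerSeries σ R => ∑ i, (pderiv R i f).subst a * pderiv R j (a i))
    ?_ ?_ ?_) f
  · exact (continuous_pderiv j).comp (continuous_subst ha)
  · refine continuous_finsetSum _ fun i _ => ?_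
    exact ((continuous_subst ha).comp (continuous_pderiv i)).mul continuous_const
  · funext p
    exact key p

-- Two descriptions of setting the variables in `τ` to zero: `killCompl` gives the coefficients,
-- `subst` composes with other substitutions.
open scoped MvPowerSeries.WithPiTopology in
theorem killCompl_inl_eq_subst [Finite σ] [Finite τ] (f : MvPowerSeries (σ ⊕ τ) R) :
    killCompl Function.Embedding.inl f = f.subst (Sum.elim X 0 : σ ⊕ τ → MvPowerSeries σ R) := by
  have ha : HasSubst (Sum.elim X 0 : σ ⊕ τ → MvPowerSeries σ R) :=
    hasSubst_of_constantCoeff_zero (by rintro (i | i) <;> simp)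
  let : UniformSpace R := ⊥
  have : DiscreteUniformity R := ⟨rfl⟩
  refine congr_fun ((WithPiTopology.denseRange_toMvPowerSeries (σ := σ ⊕ τ) (R := R)).equalizer
    (g := killCompl (R := R) Function.Embedding.inl) (h := subst (Sum.elim X 0))
    ?_ (continuous_subst ha) ?_) f
  · exact continuous_pi fun n => WithPiTopology.continuous_coeff R _
  · rw [← coe_substAlgHom ha]
    have : (killCompl (R := R) (Function.Embedding.inl : σ ↪ σ ⊕ τ)).comp
        (MvPolynomial.coeToMvPowerSeries.algHom R) = (substAlgHom ha).comp
        (MvPolynomial.coeToMvPowerSeries.algHom R) := by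
      apply MvPolynomial.algHom_ext
      rintro (i | i)
      · have := killCompl_X (R := R) (e := (Function.Embedding.inl : σ ↪ σ ⊕ τ)) i
        simpa [MvPolynomial.coeToMvPowerSeries.algHom_apply, substAlgHom_X, subst_X ha] using this
      · have := killCompl_X_eq_zero (R := R) (e := (Function.Embedding.inl : σ ↪ σ ⊕ τ))
          (t := Sum.inr i) (by simp)
        simpa [MvPolynomial.coeToMvPowerSeries.algHom_apply, substAlgHom_X, subst_X ha] using this
    funext p
    simpa [MvPolynomial.coeToMvPowerSeries.algHom_apply] using DFunLike.congr_fun this p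

/-- Induction on `s`: the terms free of `X i` form a series to which the induction hypothesis
applies, and the others are divisible by `X i`. -/
theorem exists_eq_sum_X_mul_of_coeff_eq_zero (s : Finset σ) {f : MvPowerSeries σ R}
    (hf : ∀ n : σ →₀ ℕ, (∀ i ∈ s, n i = 0) → coeff n f = 0) :
    ∃ g : σ → MvPowerSeries σ R, f = ∑ i ∈ s, X i * g i := by
  classical
  induction s using Finset.induction_on generalizing f with
  | empty =>
    refine ⟨0, ?_⟩
    ext n
    simpa using hf n (by simp)
  | insert i s hi ih =>
    let f₀ : MvPowerSeries σ R := fun n => if n i = 0 then coeff n f else 0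
    have hf₀ : ∀ n, coeff n f₀ = if n i = 0 then coeff n f else 0 := fun n => rfl
    obtain ⟨g, hg⟩ := ih (f := f₀) (by
      intro n hn
      rw [hf₀]
      split_ifs with h
      · exact hf n (by simpa [h] using hn)
      · rfl)
    obtain ⟨h, hh⟩ : X i ∣ f - f₀ := by
      rw [X_dvd_iff]
      intro n hn
      simp [hf₀, hn]
    refine ⟨Function.update g i h, ?_⟩
    rw [Finset.sum_insert hi, Function.update_self, ← hh]
    have : ∑ x ∈ s, X x * Function.update g i h x = f₀ := by
      rw [hg]
      refine Finset.sum_congr rfl fun x hx => ?_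
      rw [Function.update_of_ne (by rintro rfl; exact hi hx)]
    rw [this, sub_add_cancel]

/-- Hadamard's lemma for formal power series. -/
theorem exists_subst_sub_subst_eq_sum [Fintype σ] {a b : σ → MvPowerSeries τ R}
    (ha : ∀ i, constantCoeff (a i) = 0) (hb : ∀ i, constantCoeff (b i) = 0)
    (f : MvPowerSeries σ R) :
    ∃ g : σ → MvPowerSeries τ R, f.subst a - f.subst b = ∑ i, (a i - b i) * g i ∧
      ∀ i, constantCoeff (g i) = constantCoeff (pderiv R i f) := by
  classical
  -- With doubled variables, `f(x + y) - f(x)` vanishes at `y = 0` and so is a combination of the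
  -- `y_i`. Putting `x = b`, `y = a - b` gives the formula; differentiating in `y_i` at the origin
  -- gives the constant terms.
  let t : σ → MvPowerSeries (σ ⊕ σ) R := fun i => X (Sum.inl i) + X (Sum.inr i)
  have ht0 : ∀ i, constantCoeff (t i) = 0 := fun i => by simp [t]
  have ht : HasSubst t := hasSubst_of_constantCoeff_zero ht0
  let l : σ → MvPowerSeries (σ ⊕ σ) R := fun i => X (Sum.inl i)
  have hl0 : ∀ i, constantCoeff (l i) = 0 := fun i => by simp [l]
  have hl : HasSubst l := hasSubst_of_constantCoeff_zero hl0
  let G := f.subst t - f.subst l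
  have hz0 : ∀ i, constantCoeff ((Sum.elim X 0 : σ ⊕ σ → MvPowerSeries σ R) i) = 0 := by
    rintro (i | i) <;> simp
  have hz := hasSubst_of_constantCoeff_zero hz0
  have hG : killCompl Function.Embedding.inl G = 0 := by
    rw [killCompl_inl_eq_subst, subst_sub hz, subst_comp_subst_apply ht hz,
      subst_comp_subst_apply hl hz, sub_eq_zero]
    congr 1
    funext i
    simp only [t, l, subst_add hz, subst_X hz]
    simp
  obtain ⟨g, hg⟩ := exists_eq_sum_X_mul_of_coeff_eq_zero
    (Finset.univ.map (Function.Embedding.inr : σ ↪ σ ⊕ σ)) (f := G) (by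
      intro n hn
      have hn' : n ∈ Set.range (embDomain (Function.Embedding.inl : σ ↪ σ ⊕ σ)) := by
        rw [mem_range_embDomain_iff]
        rintro (i | i) hi
        · exact ⟨i, rfl⟩
        · exact absurd (hn (Sum.inr i) (by simp)) (by simpa using hi)
      obtain ⟨m, rfl⟩ := hn'
      rw [← coeff_killCompl, hG, coeff_zero])
  rw [Finset.sum_map] at hg
  let c : σ ⊕ σ → MvPowerSeries τ R := Sum.elim b (fun i => a i - b i)
  have hc0 : ∀ i, constantCoeff (c i) = 0 := by
    rintro (i | i) <;> simp [c, ha, hb]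
  have hc : HasSubst c := hasSubst_of_constantCoeff_zero hc0
  refine ⟨fun i => (g (Sum.inr i)).subst c, ?_, fun i => ?_⟩
  · have h := congrArg (subst c) hg
    simp only [G] at h
    rw [subst_sub hc, subst_comp_subst_apply ht hc, subst_comp_subst_apply hl hc,
      ← coe_substAlgHom hc, map_sum] at h
    simp only [map_mul, coe_substAlgHom] at h
    convert h using 2
    · congr 1
      funext i
      simp [t, subst_add hc, subst_X hc, c]
    · congr 1
      funext i
      simp [l, subst_X hc, c]
    · simp [subst_X hc, c]
  · rw [constantCoeff_subst_of_constantCoeff_zero hc hc0]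
    have h₁ : constantCoeff (pderiv R (Sum.inr i) G) = constantCoeff (pderiv R i f) := by
      simp only [G]
      rw [map_sub, pderiv_subst ht, pderiv_subst hl, map_sub, map_sum, map_sum,
        Finset.sum_eq_single i, Finset.sum_eq_zero]
      · simp [t, constantCoeff_subst_of_constantCoeff_zero ht ht0]
      · intro j _
        simp [l]
      · intro j _ hj
        have : (Sum.inr j : σ ⊕ σ) ≠ Sum.inr i := by simpa using hj
        simp [t, pderiv_X_of_ne this]
      · simp
    rw [← h₁, hg, map_sum, map_sum, Finset.sum_eq_single i]
    · simp [Derivation.leibniz]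
    · intro j _ hj
      have : (Sum.inr j : σ ⊕ σ) ≠ Sum.inr i := by simpa using hj
      simp [Derivation.leibniz, pderiv_X_of_ne this]
    · simp

end Calculus

end MvPowerSeries

end

/-! ### Formal implicit function theorem. -/

noncomputable section

namespace MvPowerSeries

open Finsupp

section FixedPoint

variable {σ τ ρ R : Type*} [CommRing R]

theorem le_order_sum {ι : Type*} (s : Finset ι) {f : ι → MvPowerSeries σ R} {k : ℕ∞}
    (h : ∀ i ∈ s, k ≤ (f i).order) : k ≤ (∑ i ∈ s, f i).order := by
  refine le_order fun d hd => ?_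
  rw [map_sum]
  exact Finset.sum_eq_zero fun i hi => coeff_of_lt_order (hd.trans_le (h i hi))

theorem eq_zero_of_forall_le_order {f : MvPowerSeries σ R} (h : ∀ k : ℕ, (k : ℕ∞) ≤ f.order) :
    f = 0 := by
  ext n
  exact coeff_of_lt_order (lt_of_lt_of_le (by exact_mod_cast n.degree.lt_succ_self)
    (h (n.degree + 1)))

/-- Substitution into a series without linear part in the variables indexed by `τ` is contracting
in these variables. -/
theorem exists_subst_sumElim_sub_eq_sum [Finite σ] [Fintype τ] {f : MvPowerSeries (σ ⊕ τ) R}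
    (hf : ∀ j, constantCoeff (pderiv R (Sum.inr j) f) = 0) {x : σ → MvPowerSeries ρ R}
    (hx : ∀ i, constantCoeff (x i) = 0) {a b : τ → MvPowerSeries ρ R}
    (ha : ∀ i, constantCoeff (a i) = 0) (hb : ∀ i, constantCoeff (b i) = 0) :
    ∃ g : τ → MvPowerSeries ρ R, (∀ i, constantCoeff (g i) = 0) ∧
      f.subst (Sum.elim x a) - f.subst (Sum.elim x b) = ∑ i, (a i - b i) * g i := by
  have := Fintype.ofFinite σ
  obtain ⟨g, hg, hg0⟩ := exists_subst_sub_subst_eq_sum (a := Sum.elim x a) (b := Sum.elim x b)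
    (by rintro (i | i) <;> simp [hx, ha]) (by rintro (i | i) <;> simp [hx, hb]) f
  refine ⟨fun i => g (Sum.inr i), fun i => by rw [hg0, hf], ?_⟩
  rw [hg, Fintype.sum_sum_type]
  simp

/-- The Hadamard cofactors have no constant term, so each application of `f` gains one order of
agreement. -/
theorem le_order_subst_sumElim_sub [Finite σ] [Finite τ] {f : MvPowerSeries (σ ⊕ τ) R}
    (hf : ∀ j, constantCoeff (pderiv R (Sum.inr j) f) = 0) {x : σ → MvPowerSeries ρ R}
    (hx : ∀ i, constantCoeff (x i) = 0) {a b : τ → MvPowerSeries ρ R}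
    (ha : ∀ i, constantCoeff (a i) = 0) (hb : ∀ i, constantCoeff (b i) = 0) {k : ℕ}
    (hk : ∀ i, (k : ℕ∞) ≤ (a i - b i).order) :
    ((k + 1 : ℕ) : ℕ∞) ≤ (f.subst (Sum.elim x a) - f.subst (Sum.elim x b)).order := by
  have := Fintype.ofFinite τ
  obtain ⟨g, hg0, hg⟩ := exists_subst_sumElim_sub_eq_sum hf hx ha hb
  rw [hg]
  refine le_order_sum _ fun i _ => le_trans ?_ le_order_mul
  rw [Nat.cast_add, Nat.cast_one]
  exact add_le_add (hk i) (one_le_order_iff_constCoeff_eq_zero.mpr (hg0 i))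

/-- The map `y ↦ F(x, y)` on tuples of formal power series in `x`. -/
def substRight (F : τ → MvPowerSeries (σ ⊕ τ) R) (y : τ → MvPowerSeries σ R) :
    τ → MvPowerSeries σ R :=
  fun i => (F i).subst (Sum.elim X y)

variable [Finite σ] [Finite τ] {F : τ → MvPowerSeries (σ ⊕ τ) R}

theorem hasSubst_sumElim_X {y : τ → MvPowerSeries σ R} (hy : ∀ i, constantCoeff (y i) = 0) :
    HasSubst (Sum.elim X y : σ ⊕ τ → MvPowerSeries σ R) :=
  hasSubst_of_constantCoeff_zero (by rintro (i | i) <;> simp [hy])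

theorem constantCoeff_iterate_substRight (hF : ∀ i, constantCoeff (F i) = 0) (k : ℕ) (i : τ) :
    constantCoeff ((substRight F)^[k] 0 i) = 0 := by
  induction k generalizing i with
  | zero => simp
  | succ k ih =>
    rw [Function.iterate_succ_apply', substRight, constantCoeff_subst_of_constantCoeff_zero
      (hasSubst_sumElim_X ih) (by rintro (i | i) <;> simp [ih]), hF]

/-- The formal implicit function theorem, in the form of a fixed point theorem: the equation
`Ψ = F(x, Ψ)` has a solution, the limit of the iterates of `y ↦ F(x, y)`. -/
theorem exists_fixedPoint_substRight (hF : ∀ i, constantCoeff (F i) = 0)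
    (hF' : ∀ i j, constantCoeff (pderiv R (Sum.inr j) (F i)) = 0) :
    ∃ Ψ : τ → MvPowerSeries σ R, (∀ i, constantCoeff (Ψ i) = 0) ∧ substRight F Ψ = Ψ ∧
      ∀ k i n, n.degree < k → coeff n (Ψ i) = coeff n ((substRight F)^[k] 0 i) := by
  have hX : ∀ i, constantCoeff (X i : MvPowerSeries σ R) = 0 := by simp
  set u : ℕ → τ → MvPowerSeries σ R := fun k => (substRight F)^[k] 0 with hu
  have hu0 : ∀ k i, constantCoeff (u k i) = 0 := constantCoeff_iterate_substRight hF
  have hus : ∀ k, u (k + 1) = substRight F (u k) := fun k =>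
    Function.iterate_succ_apply' (substRight F) k 0
  have step : ∀ (k : ℕ) i, (k : ℕ∞) ≤ (u (k + 1) i - u k i).order := by
    intro k
    induction k with
    | zero => simp
    | succ k ih =>
      intro i
      rw [hus (k + 1), congrFun (hus k) i]
      exact le_order_subst_sumElim_sub (hF' i) hX (hu0 _) (hu0 _) ih
  have stable : ∀ k l i n, n.degree < k → k ≤ l → coeff n (u l i) = coeff n (u k i) := by
    intro k l i n hn hkl
    induction l, hkl using Nat.le_induction with
    | base => rfl
    | succ l hkl ih =>
      rw [← ih, ← sub_eq_zero, ← map_sub]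
      exact coeff_of_lt_order (lt_of_lt_of_le (by exact_mod_cast hn.trans_le hkl) (step l i))
  -- The coefficients of degree `m` no longer change from the iterate `m + 1` on.
  let Ψ : τ → MvPowerSeries σ R := fun i n => coeff n (u (n.degree + 1) i)
  have hΨ : ∀ i n, coeff n (Ψ i) = coeff n (u (n.degree + 1) i) := fun i n => rfl
  have approx : ∀ k i n, n.degree < k → coeff n (Ψ i) = coeff n (u k i) := fun k i n hn =>
    (hΨ i n).trans (stable _ _ i n (Nat.lt_succ_self _) hn).symm
  have hΨ0 : ∀ i, constantCoeff (Ψ i) = 0 := fun i => by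
    rw [← coeff_zero_eq_constantCoeff_apply, hΨ, coeff_zero_eq_constantCoeff_apply, hu0]
  have hord : ∀ (k : ℕ) i, (k : ℕ∞) ≤ (Ψ i - u k i).order := fun k i => nat_le_order fun n hn => by
    rw [map_sub, approx k i n hn, sub_self]
  refine ⟨Ψ, hΨ0, ?_, approx⟩
  funext i
  rw [← sub_eq_zero]
  refine eq_zero_of_forall_le_order fun k => ?_
  have h₁ := le_order_subst_sumElim_sub (hF' i) hX hΨ0 (hu0 k) (hord k)
  have h₂ := hord (k + 1) i
  rw [hus] at h₂
  -- Compare through the next iterate `F(x, u k)`: both differences have order at least `k`.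
  have h₃ : substRight F Ψ i - Ψ i =
      ((F i).subst (Sum.elim X Ψ) - (F i).subst (Sum.elim X (u k))) +
        -(Ψ i - substRight F (u k) i) := by
    simp only [substRight]
    ring
  rw [h₃]
  refine le_trans ?_ min_order_le_add
  rw [order_neg]
  exact le_min (le_trans (by exact_mod_cast k.le_succ) h₁)
    (le_trans (by exact_mod_cast k.le_succ) h₂)

theorem fixedPoint_substRight_unique
    (hF' : ∀ i j, constantCoeff (pderiv R (Sum.inr j) (F i)) = 0) {Φ Ψ : τ → MvPowerSeries σ R}
    (hΦ₀ : ∀ i, constantCoeff (Φ i) = 0) (hΦ : substRight F Φ = Φ)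
    (hΨ₀ : ∀ i, constantCoeff (Ψ i) = 0) (hΨ : substRight F Ψ = Ψ) : Φ = Ψ := by
  have h : ∀ (k : ℕ) i, (k : ℕ∞) ≤ (Φ i - Ψ i).order := by
    intro k
    induction k with
    | zero => simp
    | succ k ih =>
      intro i
      rw [← congrFun hΦ i, ← congrFun hΨ i]
      exact le_order_subst_sumElim_sub (hF' i) (by simp) hΦ₀ hΨ₀ ih
  funext i
  exact sub_eq_zero.mp (eq_zero_of_forall_le_order fun k => h k i)

end FixedPoint

end MvPowerSeries

end

/-! ### Weighted `ℓ¹`-norms of power series. -/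

noncomputable section

namespace MvPowerSeries

open Finsupp
open scoped ENNReal

section WeightedNorm

variable {σ τ : Type*}

/-- The weighted `ℓ¹`-norm `∑ ‖f_n‖ w^n` of a power series, for a family `w` of radii. -/
def weightedNorm (w : σ → ℝ≥0∞) (f : MvPowerSeries σ ℂ) : ℝ≥0∞ :=
  ∑' n : σ →₀ ℕ, ‖coeff n f‖ₑ * n.prod fun i e => w i ^ e

theorem weightedNorm_mono {v w : σ → ℝ≥0∞} (h : ∀ i, v i ≤ w i) (f : MvPowerSeries σ ℂ) :
    weightedNorm v f ≤ weightedNorm w f :=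
  ENNReal.tsum_le_tsum fun _ => mul_le_mul_right
    (Finset.prod_le_prod' fun i _ => pow_le_pow_left₀ zero_le (h i) _) _

theorem weightedNorm_add (w : σ → ℝ≥0∞) (f g : MvPowerSeries σ ℂ) :
    weightedNorm w (f + g) ≤ weightedNorm w f + weightedNorm w g := by
  unfold weightedNorm
  rw [← ENNReal.tsum_add]
  refine ENNReal.tsum_le_tsum fun n => ?_
  rw [map_add, ← add_mul]
  exact mul_le_mul_left (enorm_add_le _ _) _

theorem weightedNorm_monomial (w : σ → ℝ≥0∞) (n : σ →₀ ℕ) (c : ℂ) :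
    weightedNorm w (monomial n c) = ‖c‖ₑ * n.prod fun i e => w i ^ e := by
  classical
  unfold weightedNorm
  rw [tsum_eq_single n]
  · rw [coeff_monomial_same]
  · intro m hm
    rw [coeff_monomial_ne hm]
    simp

theorem weightedNorm_C (w : σ → ℝ≥0∞) (c : ℂ) : weightedNorm w (C c) = ‖c‖ₑ := by
  rw [← monomial_zero_eq_C_apply, weightedNorm_monomial]
  simp

theorem weightedNorm_one (w : σ → ℝ≥0∞) : weightedNorm w (1 : MvPowerSeries σ ℂ) = 1 := by
  simpa using weightedNorm_C w 1

theorem weightedNorm_X (w : σ → ℝ≥0∞) (i : σ) :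
    weightedNorm w (X i : MvPowerSeries σ ℂ) = w i := by
  rw [X, weightedNorm_monomial]
  simp

theorem weightedNorm_mul (w : σ → ℝ≥0∞) (f g : MvPowerSeries σ ℂ) :
    weightedNorm w (f * g) ≤ weightedNorm w f * weightedNorm w g := by
  classical
  unfold weightedNorm
  simp_rw [← ENNReal.tsum_mul_right, ← ENNReal.tsum_mul_left]
  rw [← ENNReal.tsum_prod (f := fun p q : σ →₀ ℕ => ‖coeff p f‖ₑ * (p.prod fun i e => w i ^ e) *
      (‖coeff q g‖ₑ * (q.prod fun i e => w i ^ e))),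
    ← Finset.HasAntidiagonal.sigmaAntidiagonalEquivProd.tsum_eq, ENNReal.tsum_sigma']
  refine ENNReal.tsum_le_tsum fun n => ?_
  rw [tsum_fintype, coeff_mul, ← Finset.sum_coe_sort]
  refine (mul_le_mul_left (enorm_sum_le _ _) _).trans ?_
  rw [Finset.sum_mul]
  refine Finset.sum_le_sum fun p _ => ?_
  obtain ⟨p, hp⟩ := p
  obtain rfl := Finset.HasAntidiagonal.mem_antidiagonal.mp hp
  rw [Finsupp.prod_add_index' (by simp) (by simp [pow_add]), enorm_mul]
  simp only [Finset.HasAntidiagonal.sigmaAntidiagonalEquivProd_apply]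
  exact le_of_eq (by ring)

theorem weightedNorm_pow (w : σ → ℝ≥0∞) (f : MvPowerSeries σ ℂ) (k : ℕ) :
    weightedNorm w (f ^ k) ≤ weightedNorm w f ^ k := by
  induction k with
  | zero => simp [weightedNorm_one]
  | succ k ih =>
    rw [pow_succ, pow_succ]
    exact (weightedNorm_mul w _ _).trans (mul_le_mul_left ih _)

theorem weightedNorm_prod {ι : Type*} (w : σ → ℝ≥0∞) (s : Finset ι)
    (f : ι → MvPowerSeries σ ℂ) :
    weightedNorm w (∏ i ∈ s, f i) ≤ ∏ i ∈ s, weightedNorm w (f i) := by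
  classical
  induction s using Finset.induction_on with
  | empty => simp [weightedNorm_one]
  | insert i s hi ih =>
    rw [Finset.prod_insert hi, Finset.prod_insert hi]
    exact (weightedNorm_mul w _ _).trans (mul_le_mul_right ih _)

/-- The norm of the inserted series serves as the radius of the variable it replaces. Values in `[0,
∞]` allow sums to be exchanged without any summability condition. -/
theorem weightedNorm_subst {a : σ → MvPowerSeries τ ℂ} (ha : HasSubst a) (w : τ → ℝ≥0∞)
    (f : MvPowerSeries σ ℂ) :
    weightedNorm w (f.subst a) ≤ weightedNorm (fun i => weightedNorm w (a i)) f := by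
  have h : ∀ e, ‖coeff e (f.subst a)‖ₑ ≤
      ∑' d : σ →₀ ℕ, ‖coeff d f‖ₑ * ‖coeff e (d.prod fun i k => a i ^ k)‖ₑ := by
    intro e
    rw [coeff_subst ha, finsum_eq_sum _ (coeff_subst_finite ha f e)]
    refine (enorm_sum_le _ _).trans ?_
    simp only [smul_eq_mul, enorm_mul]
    exact ENNReal.sum_le_tsum _
  calc weightedNorm w (f.subst a)
      ≤ ∑' e : τ →₀ ℕ, (∑' d : σ →₀ ℕ, ‖coeff d f‖ₑ * ‖coeff e (d.prod fun i k => a i ^ k)‖ₑ) *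
          e.prod fun i k => w i ^ k := ENNReal.tsum_le_tsum fun e => mul_le_mul_left (h e) _
    _ = ∑' d : σ →₀ ℕ, ‖coeff d f‖ₑ * weightedNorm w (d.prod fun i k => a i ^ k) := by
      simp_rw [← ENNReal.tsum_mul_right, weightedNorm, ← ENNReal.tsum_mul_left]
      rw [ENNReal.tsum_comm]
      simp_rw [mul_assoc]
    _ ≤ _ := ENNReal.tsum_le_tsum fun d => mul_le_mul_right
      ((weightedNorm_prod w _ _).trans
        (Finset.prod_le_prod' fun i _ => weightedNorm_pow w _ _)) _

theorem weightedNorm_rename {e : σ → τ} [Finite σ] [Finite τ] (w : τ → ℝ≥0∞)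
    (f : MvPowerSeries σ ℂ) :
    weightedNorm w (rename e f) ≤ weightedNorm (w ∘ e) f := by
  rw [rename_eq_subst]
  refine (weightedNorm_subst (HasSubst.X_comp e) w f).trans (le_of_eq ?_)
  congr 1
  funext i
  exact weightedNorm_X w (e i)

theorem weightedNorm_map_starRingEnd (w : σ → ℝ≥0∞) (f : MvPowerSeries σ ℂ) :
    weightedNorm w (map (starRingEnd ℂ) f) = weightedNorm w f := by
  unfold weightedNorm
  simp [← ofReal_norm]

theorem weightedNorm_pderiv_le (r : ℝ≥0∞) (i : σ) (f : MvPowerSeries σ ℂ) :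
    r * weightedNorm (fun _ => r) (pderiv ℂ i f) ≤ weightedNorm (fun _ => 2 * r) f := by
  classical
  unfold weightedNorm
  rw [← ENNReal.tsum_mul_left]
  refine le_trans (ENNReal.tsum_le_tsum fun n => ?_)
    (ENNReal.tsum_comp_le_tsum_of_injective (f := fun n : σ →₀ ℕ => n + single i 1)
      (add_left_injective _) _)
  rw [coeff_pderiv, Finsupp.prod_add_index' (by simp) (by simp [pow_add]), enorm_mul]
  simp only [prod_single_index, pow_zero, pow_one, mul_pow, Finsupp.prod_mul]
  -- Doubling the radius contributes `2 ^ (|n| + 1)` at the exponent `n + e_i`, which absorbs the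
  -- factor `n_i + 1` produced by differentiation.
  have h : ‖((n i : ℂ) + 1)‖ₑ ≤ 2 * n.prod fun _ e => (2 : ℝ≥0∞) ^ e := by
    have h₁ : (n.prod fun _ e => (2 : ℝ≥0∞) ^ e) = 2 ^ n.degree :=
      Finset.prod_pow_eq_pow_sum _ _ _
    have h₂ : n i + 1 ≤ 2 * 2 ^ n.degree := by
      have := (le_degree i n).trans Nat.lt_two_pow_self.le
      have := Nat.one_le_two_pow (n := n.degree)
      omega
    have h₃ : ‖((n i : ℂ) + 1)‖ₑ = ((n i + 1 : ℕ) : ℝ≥0∞) := by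
      rw [← Nat.cast_succ, ← ofReal_norm, Complex.norm_natCast, ENNReal.ofReal_natCast]
    rw [h₁, h₃]
    exact_mod_cast h₂
  calc _ = ‖coeff (n + single i 1) f‖ₑ * ‖((n i : ℂ) + 1)‖ₑ * ((n.prod fun _ e => r ^ e) * r) := by
        ring
    _ ≤ _ := by
        refine (mul_le_mul_left (mul_le_mul_right h _) _).trans (le_of_eq ?_)
        ring

end WeightedNorm

end MvPowerSeries

end

/-! ### Convergent series and the analytic implicit function theorem. -/

noncomputable section

namespace FormalCR

open MvPowerSeries Finsupp Filter
open scoped ENNReal Topology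

section Convergent

variable {σ τ : Type*}

theorem isConvergent_iff_exists_weightedNorm {f : MvPowerSeries σ ℂ} :
    IsConvergent f ↔ ∃ r : ℝ≥0∞, 0 < r ∧ r ≠ ⊤ ∧ weightedNorm (fun _ => r) f ≠ ⊤ := by
  have key : ∀ r : ℝ, 0 < r → ((Summable fun n : σ →₀ ℕ => ‖coeff n f‖ * r ^ n.degree) ↔
      weightedNorm (fun _ => ENNReal.ofReal r) f ≠ ⊤) := by
    intro r hr
    have h : ∀ n : σ →₀ ℕ, ‖coeff n f‖ₑ * (n.prod fun _ e => ENNReal.ofReal r ^ e) =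
        ENNReal.ofReal (‖coeff n f‖ * r ^ n.degree) := by
      intro n
      have h₁ : (n.prod fun _ e => ENNReal.ofReal r ^ e) = ENNReal.ofReal r ^ n.degree :=
        Finset.prod_pow_eq_pow_sum _ _ _
      rw [h₁, ENNReal.ofReal_mul (norm_nonneg _), ENNReal.ofReal_pow hr.le, ofReal_norm]
    unfold weightedNorm
    simp_rw [h]
    refine ⟨fun hs => hs.tsum_ofReal_ne_top, fun hs => ?_⟩
    refine (ENNReal.summable_toReal hs).congr fun n => ?_
    rw [ENNReal.toReal_ofReal (by positivity)]
  constructor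
  · rintro ⟨r, hr, hs⟩
    exact ⟨ENNReal.ofReal r, by simpa using hr, ENNReal.ofReal_ne_top, (key r hr).mp hs⟩
  · rintro ⟨r, hr, hr', hs⟩
    have hr₀ := ENNReal.toReal_pos hr.ne' hr'
    refine ⟨r.toReal, hr₀, (key _ hr₀).mpr ?_⟩
    rwa [ENNReal.ofReal_toReal hr']

/-- In this form finitely many convergent series have a common radius. -/
theorem isConvergent_iff_eventually {f : MvPowerSeries σ ℂ} :
    IsConvergent f ↔ ∀ᶠ r in 𝓝[>] (0 : ℝ≥0∞), weightedNorm (fun _ => r) f ≠ ⊤ := by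
  rw [isConvergent_iff_exists_weightedNorm]
  constructor
  · rintro ⟨r, hr, -, hs⟩
    filter_upwards [Ioo_mem_nhdsGT hr] with s hs'
    exact ne_top_of_le_ne_top hs (weightedNorm_mono (fun _ => hs'.2.le) f)
  · intro h
    obtain ⟨r, hr, hr₀, hr₁⟩ :=
      (h.and (Ioo_mem_nhdsGT (show (0 : ℝ≥0∞) < 1 from zero_lt_one))).exists
    exact ⟨r, hr₀, (hr₁.trans ENNReal.one_lt_top).ne, hr⟩

theorem isConvergent_C (c : ℂ) : IsConvergent (C c : MvPowerSeries σ ℂ) :=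
  isConvergent_iff_eventually.mpr (.of_forall fun r => by
    rw [weightedNorm_C]
    exact enorm_ne_top)

theorem isConvergent_X (i : σ) : IsConvergent (X i : MvPowerSeries σ ℂ) :=
  isConvergent_iff_exists_weightedNorm.mpr ⟨1, zero_lt_one, ENNReal.one_ne_top, by
    rw [weightedNorm_X]
    exact ENNReal.one_ne_top⟩

theorem IsConvergent.add {f g : MvPowerSeries σ ℂ} (hf : IsConvergent f) (hg : IsConvergent g) :
    IsConvergent (f + g) := by
  rw [isConvergent_iff_eventually] at *
  filter_upwards [hf, hg] with r h₁ h₂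
  exact ne_top_of_le_ne_top (ENNReal.add_ne_top.mpr ⟨h₁, h₂⟩) (weightedNorm_add _ f g)

theorem IsConvergent.mul {f g : MvPowerSeries σ ℂ} (hf : IsConvergent f) (hg : IsConvergent g) :
    IsConvergent (f * g) := by
  rw [isConvergent_iff_eventually] at *
  filter_upwards [hf, hg] with r h₁ h₂
  exact ne_top_of_le_ne_top (ENNReal.mul_ne_top h₁ h₂) (weightedNorm_mul _ f g)

theorem IsConvergent.rename [Finite σ] [Finite τ] {f : MvPowerSeries σ ℂ} (hf : IsConvergent f)
    (e : σ → τ) : IsConvergent (MvPowerSeries.rename e f) := by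
  rw [isConvergent_iff_eventually] at *
  filter_upwards [hf] with r h
  exact ne_top_of_le_ne_top h (weightedNorm_rename _ f)

theorem IsConvergent.bar {f : MvPowerSeries σ ℂ} (hf : IsConvergent f) :
    IsConvergent (FormalCR.bar f) := by
  rw [isConvergent_iff_eventually] at *
  filter_upwards [hf] with r h
  rwa [FormalCR.bar, weightedNorm_map_starRingEnd]

theorem IsConvergent.pderiv {f : MvPowerSeries σ ℂ} (hf : IsConvergent f) (i : σ) :
    IsConvergent (MvPowerSeries.pderiv ℂ i f) := by
  rw [isConvergent_iff_exists_weightedNorm] at *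
  obtain ⟨r, hr, hr', h⟩ := hf
  refine ⟨r / 2, ENNReal.half_pos hr.ne', (ENNReal.half_lt_self hr.ne' hr').ne_top, ?_⟩
  have h₁ := weightedNorm_pderiv_le (r / 2) i f
  rw [ENNReal.mul_div_cancel (by simp) (by simp)] at h₁
  intro h₂
  rw [h₂, ENNReal.mul_top (ENNReal.half_pos hr.ne').ne'] at h₁
  exact h (top_le_iff.mp h₁)

/-- Give the variables in `σ` weight 2 and those in `τ` weight 1. Without constant term and without
terms linear in `τ`, every monomial has weight at least 2, whence the factor `δ ^ 2`. -/
theorem weightedNorm_sumElim_le {f : MvPowerSeries (σ ⊕ τ) ℂ} (hf : constantCoeff f = 0)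
    (hf' : ∀ j, constantCoeff (MvPowerSeries.pderiv ℂ (Sum.inr j) f) = 0) {δ : ℝ≥0∞}
    (hδ : δ ≤ 1) (r : ℝ≥0∞) :
    weightedNorm (Sum.elim (fun _ => δ ^ 2 * r) (fun _ => δ * r)) f ≤
      δ ^ 2 * weightedNorm (fun _ => r) f := by
  classical
  unfold weightedNorm
  rw [← ENNReal.tsum_mul_left]
  refine ENNReal.tsum_le_tsum fun n => ?_
  by_cases hn : coeff n f = 0
  · simp [hn]
  rw [mul_left_comm]
  refine mul_le_mul_right ?_ _
  let v : σ ⊕ τ → ℕ := Sum.elim (fun _ => 2) (fun _ => 1)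
  have h₁ : (n.prod fun i e => (Sum.elim (fun _ => δ ^ 2 * r) (fun _ => δ * r) i : ℝ≥0∞) ^ e) =
      δ ^ (∑ i ∈ n.support, v i * n i) * n.prod fun _ e => r ^ e := by
    rw [← Finset.prod_pow_eq_pow_sum, Finsupp.prod, Finsupp.prod, ← Finset.prod_mul_distrib]
    refine Finset.prod_congr rfl ?_
    rintro (i | i) _ <;> simp [v, mul_pow, pow_mul]
  rw [h₁]
  refine mul_le_mul_left (pow_le_pow_of_le_one zero_le hδ ?_) _
  have hle : ∀ i ∈ n.support, v i * n i ≤ ∑ i ∈ n.support, v i * n i := fun i hi =>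
    Finset.single_le_sum (f := fun i => v i * n i) (fun _ _ => Nat.zero_le _) hi
  have hn₀ : n ≠ 0 := by
    rintro rfl
    exact hn (by simpa using hf)
  obtain ⟨i, hi⟩ := Finsupp.support_nonempty_iff.mpr hn₀
  have hi' : 1 ≤ n i := Nat.one_le_iff_ne_zero.mpr (Finsupp.mem_support_iff.mp hi)
  rcases i with i | i
  · refine le_trans ?_ (hle _ hi)
    simp only [v, Sum.elim_inl]
    omega
  by_cases hi₂ : 2 ≤ n (Sum.inr i)
  · refine le_trans ?_ (hle _ hi)
    simp only [v, Sum.elim_inr]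
    omega
  -- Here the variable `inr i` occurs with exponent 1; if it occurred alone, the monomial would be
  -- one of the excluded linear terms.
  obtain ⟨j, hj, hji⟩ : ∃ j ∈ n.support, j ≠ Sum.inr i := by
    by_contra! h
    have hs : n = single (Sum.inr i) 1 := by
      ext k
      by_cases hk : k = Sum.inr i
      · subst hk
        simp only [single_eq_same]
        omega
      · rw [single_eq_of_ne hk]
        exact Finsupp.notMem_support_iff.mp fun hk' => hk (h k hk')
    have := hf' i
    rw [← coeff_zero_eq_constantCoeff_apply, coeff_pderiv, zero_add, ← hs] at this
    exact hn (by simpa using this)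
  have hj' : 1 ≤ n j := Nat.one_le_iff_ne_zero.mpr (Finsupp.mem_support_iff.mp hj)
  have hpair : ∑ k ∈ {Sum.inr i, j}, v k * n k ≤ ∑ k ∈ n.support, v k * n k :=
    Finset.sum_le_sum_of_subset (by
      intro k hk
      rcases Finset.mem_insert.mp hk with rfl | hk
      · exact hi
      · rwa [Finset.mem_singleton.mp hk])
  rw [Finset.sum_pair hji.symm] at hpair
  have hv : ∀ k, 1 ≤ v k := by rintro (k | k) <;> simp [v]
  have h₂ := Nat.mul_le_mul (hv (Sum.inr i)) hi'
  have h₃ := Nat.mul_le_mul (hv j) hj'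
  omega

/-- A finite partial sum involves bounded degrees only and is therefore a partial sum for some `u
k`. -/
theorem weightedNorm_le_of_coeff_eq {w : σ → ℝ≥0∞} {f : MvPowerSeries σ ℂ}
    {u : ℕ → MvPowerSeries σ ℂ} (h : ∀ k n, n.degree < k → coeff n f = coeff n (u k))
    {s : ℝ≥0∞} (hu : ∀ k, weightedNorm w (u k) ≤ s) : weightedNorm w f ≤ s := by
  unfold weightedNorm
  rw [ENNReal.tsum_eq_iSup_sum]
  refine iSup_le fun S => ?_
  have hS : ∀ n ∈ S, n.degree < S.sup degree + 1 := fun n hn =>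
    Nat.lt_succ_of_le (Finset.le_sup hn)
  refine le_trans ?_ (hu (S.sup degree + 1))
  rw [Finset.sum_congr rfl fun n hn => by rw [h _ n (hS n hn)]]
  exact ENNReal.sum_le_tsum S

/-- The analytic implicit function theorem. -/
theorem IsConvergent.of_substRight_eq [Finite σ] [Finite τ] {F : τ → MvPowerSeries (σ ⊕ τ) ℂ}
    (hF : ∀ i, constantCoeff (F i) = 0)
    (hF' : ∀ i j, constantCoeff (MvPowerSeries.pderiv ℂ (Sum.inr j) (F i)) = 0)
    (hconv : ∀ i, IsConvergent (F i)) {Ψ : τ → MvPowerSeries σ ℂ}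
    (hΨ₀ : ∀ i, constantCoeff (Ψ i) = 0) (hΨ : substRight F Ψ = Ψ) (i : τ) :
    IsConvergent (Ψ i) := by
  have := Fintype.ofFinite τ
  obtain ⟨Φ, hΦ₀, hΦ, hlim⟩ := exists_fixedPoint_substRight hF hF'
  obtain rfl := fixedPoint_substRight_unique hF' hΦ₀ hΦ hΨ₀ hΨ
  obtain ⟨r, hr, hr₀, hr₁⟩ :=
    ((eventually_all.mpr fun i => isConvergent_iff_eventually.mp (hconv i)).and
      (Ioo_mem_nhdsGT (show (0 : ℝ≥0∞) < 1 from zero_lt_one))).exists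
  let c : ℝ≥0∞ := ∑ i, weightedNorm (fun _ => r) (F i)
  have hc : c + 1 ≠ ⊤ := ENNReal.add_ne_top.mpr
    ⟨ENNReal.sum_ne_top.mpr fun i _ => hr i, ENNReal.one_ne_top⟩
  -- Chosen so that `δ * c ≤ r`: then `δ ^ 2 * c ≤ δ * r`, and the ball of radius `δ * r` is
  -- preserved by the iteration. The `+ 1` keeps the denominator nonzero.
  let δ : ℝ≥0∞ := min 1 (r / (c + 1))
  have hδ₀ : 0 < δ := lt_min zero_lt_one (ENNReal.div_pos hr₀.ne' hc)
  have hδ₁ : δ ≤ 1 := min_le_left _ _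
  have hδc : δ * c ≤ r := calc
    δ * c ≤ r / (c + 1) * (c + 1) := mul_le_mul' (min_le_right _ _) le_self_add
    _ = r := ENNReal.div_mul_cancel (by simp) hc
  have hδt : δ ≠ ⊤ := (hδ₁.trans_lt ENNReal.one_lt_top).ne
  have hrt : r ≠ ⊤ := (hr₁.trans ENNReal.one_lt_top).ne
  have hbound : ∀ k i, weightedNorm (fun _ => δ ^ 2 * r) ((substRight F)^[k] 0 i) ≤ δ * r := by
    intro k
    induction k with
    | zero => intro i; simp [weightedNorm]
    | succ k ih =>
      intro i
      rw [Function.iterate_succ_apply', substRight]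
      refine (weightedNorm_subst (hasSubst_sumElim_X
        (constantCoeff_iterate_substRight hF k)) _ _).trans ?_
      calc _ ≤ weightedNorm (Sum.elim (fun _ => δ ^ 2 * r) (fun _ => δ * r)) (F i) := by
            refine weightedNorm_mono ?_ _
            rintro (j | j)
            · simp [weightedNorm_X]
            · simpa using ih j
        _ ≤ δ ^ 2 * weightedNorm (fun _ => r) (F i) :=
            weightedNorm_sumElim_le (hF i) (hF' i) hδ₁ r
        _ ≤ δ ^ 2 * c := mul_le_mul_right (Finset.single_le_sum
            (f := fun i => weightedNorm (fun _ => r) (F i)) (fun _ _ => zero_le)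
            (Finset.mem_univ i)) _
        _ = δ * (δ * c) := by ring
        _ ≤ δ * r := mul_le_mul_right hδc _
  refine isConvergent_iff_exists_weightedNorm.mpr ⟨δ ^ 2 * r,
    ENNReal.mul_pos (pow_ne_zero 2 hδ₀.ne') hr₀.ne',
    ENNReal.mul_ne_top (ENNReal.pow_ne_top hδt) hrt, ?_⟩
  exact ne_top_of_le_ne_top (ENNReal.mul_ne_top hδt hrt)
    (weightedNorm_le_of_coeff_eq (fun k n hn => hlim k i n hn) fun k => hbound k i)

end Convergent

end FormalCR

end

/-! ### Algebraic elements: exchange and derivations. -/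

noncomputable section

section AlgebraicIndependent

open Algebra

/-- In the matroid of algebraic independence, `x` is a basis of its algebraic closure. The
independent family `v` lies in this closure and has the same finite cardinality, so it is a basis as
well. -/
theorem isAlgebraic_adjoin_range_of_algebraicIndependent {ι R A : Type*} [Finite ι] [CommRing R]
    [CommRing A] [IsDomain A] [Algebra R A] [Nontrivial R] [FaithfulSMul R A] {x v : ι → A}
    (hx : AlgebraicIndependent R x) (hv : AlgebraicIndependent R v)
    (h : ∀ i, IsAlgebraic (adjoin R (Set.range x)) (v i)) (i : ι) :
    IsAlgebraic (adjoin R (Set.range v)) (x i) := by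
  let M := AlgebraicIndependent.matroid R A
  let T : Set A := {a | IsAlgebraic (adjoin R (Set.range x)) a}
  have hxT : Set.range x ⊆ T := by
    rintro _ ⟨j, rfl⟩
    exact isAlgebraic_algebraMap
      (⟨x j, subset_adjoin (Set.mem_range_self j)⟩ : adjoin R (Set.range x))
  have hB : M.IsBasis (Set.range x) T :=
    AlgebraicIndependent.matroid_isBasis_iff.mpr ⟨hx.to_subtype_range, hxT, fun a ha => ha⟩
  have hI : M.Indep (Set.range v) :=
    AlgebraicIndependent.matroid_indep_iff.mpr hv.to_subtype_range
  obtain ⟨J, hJ, hvJ⟩ := hI.subset_isBasis_of_subset (X := T)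
    (by rintro _ ⟨j, rfl⟩; exact h j)
  have hcard : J.encard ≤ (Set.range v).encard := by
    rw [hJ.encard_eq_encard hB, ← Set.image_univ, ← Set.image_univ, hx.injective.encard_image,
      hv.injective.encard_image]
  obtain rfl := Set.Finite.eq_of_subset_of_encard_le (Set.finite_range v) hvJ hcard
  exact (AlgebraicIndependent.matroid_isBasis_iff.mp hJ).2.2 _ (hxT (Set.mem_range_self i))

/-- A derivation that maps the base ring into itself maps algebraic elements to algebraic ones. -/
theorem IsAlgebraic.derivation {k A B : Type*} [Field k] [CharZero k] [CommRing A] [IsDomain A]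
    [CommRing B] [IsDomain B] [Algebra k A] [Algebra k B] [Algebra A B] [FaithfulSMul A B]
    (D : Derivation k B B)
    (hD : ∀ a : A, ∃ a' : A, D (algebraMap A B a) = algebraMap A B a') {x : B}
    (hx : IsAlgebraic A x) : IsAlgebraic A (D x) := by
  classical
  -- Here `c` is the value at `x` of `p` with `D` applied to its coefficients.
  have key : ∀ p : Polynomial A, ∃ c, IsAlgebraic A c ∧
      D (p.aeval x) = c + p.derivative.aeval x * D x := by
    intro p
    induction p using Polynomial.induction_on' with
    | add p q hp hq =>
      obtain ⟨c, hc, h⟩ := hp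
      obtain ⟨e, he, h'⟩ := hq
      refine ⟨c + e, hc.add he, ?_⟩
      simp only [map_add, h, h']
      ring
    | monomial n a =>
      obtain ⟨a', ha'⟩ := hD a
      refine ⟨x ^ n * algebraMap A B a', (hx.pow n).mul (isAlgebraic_algebraMap a'), ?_⟩
      simp only [Polynomial.aeval_monomial, Derivation.leibniz, Derivation.leibniz_pow, ha',
        Polynomial.derivative_monomial, smul_eq_mul, nsmul_eq_mul, map_mul, map_natCast]
      ring
  have hex : ∃ n, ∃ p : Polynomial A, p ≠ 0 ∧ p.aeval x = 0 ∧ p.natDegree = n := by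
    obtain ⟨p, hp, hpx⟩ := hx
    exact ⟨_, p, hp, hpx, rfl⟩
  -- By minimality of the degree `p'(x) ≠ 0`, so applying `D` to `p(x) = 0` determines `D x` as an
  -- algebraic quotient.
  obtain ⟨p, hp, hpx, hdeg⟩ := Nat.find_spec hex
  have hinj : Function.Injective (algebraMap A B) := FaithfulSMul.algebraMap_injective A B
  have hchar : CharZero A := charZero_of_injective_algebraMap (algebraMap k A).injective
  have hdeg₀ : p.natDegree ≠ 0 := by
    intro h
    rw [Polynomial.eq_C_of_natDegree_eq_zero h, Polynomial.aeval_C] at hpx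
    refine hp ?_
    rw [Polynomial.eq_C_of_natDegree_eq_zero h, hinj (hpx.trans (map_zero _).symm),
      Polynomial.C_0]
  have hder : p.derivative ≠ 0 := fun h =>
    hdeg₀ (Polynomial.derivative_eq_zero.mp h)
  have hne : p.derivative.aeval x ≠ 0 := by
    intro h
    refine Nat.find_min hex ?_ ⟨_, hder, h, rfl⟩
    rw [← hdeg]
    exact Polynomial.natDegree_derivative_lt hdeg₀
  obtain ⟨c, hc, h⟩ := key p
  rw [hpx, map_zero] at h
  have halg : IsAlgebraic A (p.derivative.aeval x) := by
    rw [Polynomial.aeval_eq_sum_range]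
    exact sum_mem (S := Subalgebra.algebraicClosure A B) fun i _ => (hx.pow i).smul _
  refine IsAlgebraic.of_mul (y := p.derivative.aeval x) (mem_nonZeroDivisors_of_ne_zero hne)
    halg ?_
  rw [eq_neg_of_add_eq_zero_right h.symm]
  exact hc.neg

end AlgebraicIndependent

end

/-! ### Algebraic power series: partial coefficients and closure properties. -/

noncomputable section

namespace MvPowerSeries

open Finsupp

section SumCoefficients

variable {σ τ R : Type*} [CommRing R]

/-- The coefficient of `y^m` of a series in `x` and `y`, as a series in `x`. -/
def coeffRight (m : τ →₀ ℕ) : MvPowerSeries (σ ⊕ τ) R →ₗ[R] MvPowerSeries σ R where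
  toFun f := fun n => coeff (sumFinsuppAddEquivProdFinsupp.symm (n, m)) f
  map_add' _ _ := rfl
  map_smul' _ _ := rfl

theorem coeff_coeffRight (m : τ →₀ ℕ) (f : MvPowerSeries (σ ⊕ τ) R) (n : σ →₀ ℕ) :
    coeff n (coeffRight m f) = coeff (sumFinsuppAddEquivProdFinsupp.symm (n, m)) f := rfl

theorem coeffRight_zero (f : MvPowerSeries (σ ⊕ τ) R) :
    coeffRight 0 f = killCompl Function.Embedding.inl f := by
  ext n
  rw [coeff_coeffRight, coeff_killCompl]
  refine congrArg (fun s => coeff s f) (Finsupp.ext ?_)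
  rintro (i | i)
  · rw [sumFinsuppAddEquivProdFinsupp_symm_inl]
    exact (embDomain_apply_self Function.Embedding.inl n i).symm
  · rw [sumFinsuppAddEquivProdFinsupp_symm_inr, embDomain_of_notMem_range _ _ _ (by simp)]
    rfl

/-- In a splitting of `m` the part taken from `f` is either `m` or smaller than `m`, and the smaller
ones contribute nothing. -/
theorem coeffRight_mul {m : τ →₀ ℕ} {f : MvPowerSeries (σ ⊕ τ) R}
    (hf : ∀ m' < m, coeffRight m' f = 0) (g : MvPowerSeries (σ ⊕ τ) R) :
    coeffRight m (f * g) = coeffRight m f * killCompl Function.Embedding.inl g := by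
  classical
  rw [← coeffRight_zero]
  ext n
  rw [coeff_coeffRight, coeff_mul, coeff_mul]
  symm
  refine Finset.sum_of_injOn (fun p => (sumFinsuppAddEquivProdFinsupp.symm (p.1, m),
    sumFinsuppAddEquivProdFinsupp.symm (p.2, 0))) ?_ ?_ ?_ ?_
  · rintro p _ q _ h
    simp only [Prod.mk.injEq, EmbeddingLike.apply_eq_iff_eq, and_true] at h
    exact Prod.ext h.1 h.2
  · intro p hp
    simp only [Finset.mem_coe, Finset.HasAntidiagonal.mem_antidiagonal] at hp ⊢
    rw [← map_add, Prod.mk_add_mk, hp, add_zero]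
  · rintro ⟨p, q⟩ hp hpq
    obtain ⟨⟨p₁, p₂⟩, rfl⟩ := sumFinsuppAddEquivProdFinsupp.symm.surjective p
    obtain ⟨⟨q₁, q₂⟩, rfl⟩ := sumFinsuppAddEquivProdFinsupp.symm.surjective q
    rw [Finset.HasAntidiagonal.mem_antidiagonal, ← map_add, EmbeddingLike.apply_eq_iff_eq,
      Prod.mk_add_mk, Prod.mk.injEq] at hp
    obtain ⟨h₁, h₂⟩ := hp
    have hne : p₂ ≠ m := by
      rintro rfl
      obtain rfl : q₂ = 0 := by simpa using h₂
      exact hpq ⟨(p₁, q₁), by simpa using h₁, rfl⟩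
    have hlt : p₂ < m := lt_of_le_of_ne (h₂ ▸ le_self_add) hne
    have h := congrArg (coeff p₁) (hf p₂ hlt)
    rw [coeff_coeffRight, coeff_zero] at h
    simp only [h, zero_mul]
  · intro p _
    rfl

theorem exists_coe_eq_coeffRight_coe (m : τ →₀ ℕ) (p : MvPolynomial (σ ⊕ τ) R) :
    ∃ q : MvPolynomial σ R, (q : MvPowerSeries σ R) = coeffRight m (p : MvPowerSeries _ R) := by
  classical
  induction p using MvPolynomial.induction_on' with
  | monomial s a =>
    obtain ⟨⟨s₁, s₂⟩, rfl⟩ := sumFinsuppAddEquivProdFinsupp.symm.surjective s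
    by_cases h : s₂ = m
    · refine ⟨MvPolynomial.monomial s₁ a, ?_⟩
      ext n
      rw [coeff_coeffRight, MvPolynomial.coe_monomial, MvPolynomial.coe_monomial, coeff_monomial,
        coeff_monomial]
      simp only [EmbeddingLike.apply_eq_iff_eq, Prod.mk.injEq, h, and_true]
    · refine ⟨0, ?_⟩
      ext n
      rw [coeff_coeffRight, MvPolynomial.coe_monomial, coeff_monomial]
      simp only [EmbeddingLike.apply_eq_iff_eq, Prod.mk.injEq, Ne.symm h, and_false, if_false,
        MvPolynomial.coe_zero, coeff_zero]
  | add p q hp hq =>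
    obtain ⟨p', hp'⟩ := hp
    obtain ⟨q', hq'⟩ := hq
    exact ⟨p' + q', by rw [MvPolynomial.coe_add, hp', hq', MvPolynomial.coe_add, map_add]⟩

end SumCoefficients

section Algebraic

variable {σ τ k : Type*} [Field k]

theorem algebraMap_mvPolynomial_apply (p : MvPolynomial σ k) :
    algebraMap (MvPolynomial σ k) (MvPowerSeries σ k) p = (p : MvPowerSeries σ k) := by
  rw [algebraMap_apply']
  simp

instance : IsDomain (MvPowerSeries σ k) := NoZeroDivisors.to_isDomain _

instance : FaithfulSMul (MvPolynomial σ k) (MvPowerSeries σ k) :=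
  (faithfulSMul_iff_algebraMap_injective _ _).mpr fun p q h => by
    simpa only [algebraMap_mvPolynomial_apply, MvPolynomial.coe_inj] using h

/-- Setting the variables in `τ` to zero in an algebraic equation could make all its coefficients
vanish. Instead the coefficient of `y^m` is extracted, with `m` minimal among the exponents that
occur in some coefficient of `p`; in the powers of `f` this amounts to `y = 0`, and the equation
stays nontrivial. -/
theorem isAlgebraic_killCompl_inl [Finite τ] {f : MvPowerSeries (σ ⊕ τ) k}
    (hf : IsAlgebraic (MvPolynomial (σ ⊕ τ) k) f) :
    IsAlgebraic (MvPolynomial σ k) (killCompl Function.Embedding.inl f) := by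
  classical
  obtain ⟨p, hp, hpf⟩ := hf
  let S : Set (τ →₀ ℕ) := {m | ∃ i, coeffRight m (p.coeff i : MvPowerSeries (σ ⊕ τ) k) ≠ 0}
  have hS : S.Nonempty := by
    obtain ⟨i, hi⟩ : ∃ i, p.coeff i ≠ 0 := by
      by_contra! h
      exact hp (Polynomial.ext (by simpa using h))
    obtain ⟨s, hs⟩ := MvPolynomial.ne_zero_iff.mp hi
    obtain ⟨⟨s₁, s₂⟩, rfl⟩ := sumFinsuppAddEquivProdFinsupp.symm.surjective s
    refine ⟨s₂, i, fun h => hs ?_⟩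
    have := congrArg (coeff s₁) h
    rwa [coeff_coeffRight, MvPolynomial.coeff_coe, coeff_zero] at this
  obtain ⟨m, ⟨i, hi⟩, hmin⟩ := WellFounded.has_min (wellFounded_lt (α := τ →₀ ℕ)) S hS
  have hlt : ∀ i, ∀ m' < m, coeffRight m' (p.coeff i : MvPowerSeries (σ ⊕ τ) k) = 0 := by
    intro i m' hm'
    by_contra h
    exact hmin m' ⟨i, h⟩ hm'
  choose q hq using fun i => exists_coe_eq_coeffRight_coe m (p.coeff i)
  refine ⟨∑ i ∈ Finset.range (p.natDegree + 1), Polynomial.monomial i (q i), ?_, ?_⟩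
  · intro h
    have hdeg : i < p.natDegree + 1 := by
      refine Nat.lt_succ_of_le (Polynomial.le_natDegree_of_ne_zero fun h => hi ?_)
      rw [h, MvPolynomial.coe_zero, map_zero]
    have := congrArg (fun r => Polynomial.coeff r i) h
    simp only [Polynomial.finsetSum_coeff, Polynomial.coeff_monomial, Finset.sum_ite_eq',
      Finset.mem_range, hdeg, if_true, Polynomial.coeff_zero] at this
    rw [← hq i, this, MvPolynomial.coe_zero] at hi
    exact hi rfl
  · have h := congrArg (coeffRight m) hpf
    rw [Polynomial.aeval_eq_sum_range, map_sum, map_zero] at h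
    rw [map_sum, ← h]
    refine Finset.sum_congr rfl fun j _ => ?_
    rw [Polynomial.aeval_monomial, algebraMap_mvPolynomial_apply, hq, Algebra.smul_def,
      algebraMap_mvPolynomial_apply, coeffRight_mul (hlt j), map_pow]

theorem isAlgebraic_rename {f : MvPowerSeries σ k} (hf : IsAlgebraic (MvPolynomial σ k) f)
    (e : σ ↪ τ) : IsAlgebraic (MvPolynomial τ k) (rename e f) :=
  hf.ringHom_of_comp_eq (MvPolynomial.rename e : MvPolynomial σ k →ₐ[k] MvPolynomial τ k)
    (rename (R := k) e) (MvPolynomial.rename_injective e e.injective) (by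
      refine RingHom.ext fun p => ?_
      simpa [algebraMap_mvPolynomial_apply] using (rename_coe e p).symm)

theorem isAlgebraic_pderiv [CharZero k] {f : MvPowerSeries σ k}
    (hf : IsAlgebraic (MvPolynomial σ k) f) (i : σ) :
    IsAlgebraic (MvPolynomial σ k) (pderiv k i f) :=
  hf.derivation (pderiv k i) fun p => ⟨MvPolynomial.pderiv i p, by
    rw [algebraMap_mvPolynomial_apply, algebraMap_mvPolynomial_apply, pderiv_coe]⟩

theorem isAlgebraic_map {f : MvPowerSeries σ k} (hf : IsAlgebraic (MvPolynomial σ k) f)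
    (φ : k →+* k) : IsAlgebraic (MvPolynomial σ k) (map φ f) :=
  hf.ringHom_of_comp_eq (MvPolynomial.map φ : MvPolynomial σ k →+* MvPolynomial σ k)
    (map φ) (MvPolynomial.map_injective φ φ.injective) (by
      refine RingHom.ext fun p => ?_
      simp only [RingHom.comp_apply, RingHom.coe_coe, algebraMap_mvPolynomial_apply]
      ext n
      simp [MvPolynomial.coeff_map])

end Algebraic

end MvPowerSeries

end

/-! ### Implicit function theorem for algebraic series. -/

noncomputable section

namespace MvPowerSeries

section Rename

variable {σ τ R : Type*} [CommRing R] [Finite σ]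

theorem pderiv_rename (e : σ ↪ τ) (i : σ) (f : MvPowerSeries σ R) :
    pderiv R (e i) (rename e f) = rename e (pderiv R i f) := by
  classical
  have := Fintype.ofFinite σ
  rw [rename_eq_subst, pderiv_subst (HasSubst.X_comp e), rename_eq_subst, Finset.sum_eq_single i]
  · simp
  · intro j _ hj
    simp [pderiv_X_of_ne (e.injective.ne hj)]
  · simp

theorem pderiv_rename_eq_zero (e : σ → τ) {j : τ} (hj : j ∉ Set.range e)
    (f : MvPowerSeries σ R) : pderiv R j (rename e f) = 0 := by
  have := Fintype.ofFinite σ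
  rw [rename_eq_subst, pderiv_subst (HasSubst.X_comp e)]
  refine Finset.sum_eq_zero fun i _ => ?_
  rw [Function.comp_apply, pderiv_X_of_ne (fun h => hj ⟨i, h⟩), mul_zero]

theorem subst_rename {υ : Type*} (e : σ → τ) {a : τ → MvPowerSeries υ R} (ha : HasSubst a)
    (f : MvPowerSeries σ R) : (rename e f).subst a = f.subst (a ∘ e) := by
  rw [rename_eq_subst, subst_comp_subst_apply (HasSubst.X_comp e) ha]
  congr 1
  funext i
  exact subst_X ha (e i)

end Rename

section AlgebraicImplicit

variable {σ τ k : Type*} [Field k]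

theorem aeval_eq_subst_coe {a : σ → MvPowerSeries τ k} (ha : HasSubst a) (p : MvPolynomial σ k) :
    MvPolynomial.aeval a p = (p : MvPowerSeries σ k).subst a := by
  rw [← coe_substAlgHom ha, substAlgHom_coe]


theorem aeval_X_eq_coe (p : MvPolynomial σ k) :
    MvPolynomial.aeval (X : σ → MvPowerSeries σ k) p = (p : MvPowerSeries σ k) := by
  rw [aeval_eq_subst_coe HasSubst.X, subst_self, id]

theorem algebraicIndependent_X : AlgebraicIndependent k (X : σ → MvPowerSeries σ k) :=
  algebraicIndependent_iff_injective_aeval.mpr fun p q h => by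
    simpa only [aeval_X_eq_coe, MvPolynomial.coe_inj] using h

variable [Finite σ] [Finite τ] {F : τ → MvPowerSeries (σ ⊕ τ) k}

/-- A family of algebraic series with a left inverse for composition has an algebraic left
inverse. -/
theorem isAlgebraic_of_subst_eq_X {v w : σ → MvPowerSeries σ k} (hv₀ : HasSubst v)
    (hw₀ : HasSubst w) (hv : ∀ i, IsAlgebraic (MvPolynomial σ k) (v i))
    (hwv : ∀ i, (v i).subst w = X i) (i : σ) : IsAlgebraic (MvPolynomial σ k) (w i) := by
  have hinv : ∀ p : MvPolynomial σ k,
      (MvPolynomial.aeval v p).subst w = (p : MvPowerSeries σ k) := by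
    intro p
    rw [aeval_eq_subst_coe hv₀, subst_comp_subst_apply hv₀ hw₀, funext hwv]
    exact congrFun subst_self _
  have hindep : AlgebraicIndependent k v :=
    algebraicIndependent_iff_injective_aeval.mpr fun p q h => by
      have := congrArg (subst w) h
      simpa only [hinv, MvPolynomial.coe_inj] using this
  have hX := algebraicIndependent_X (σ := σ) (k := k)
  have hvX : ∀ i, IsAlgebraic (Algebra.adjoin k (Set.range (X : σ → MvPowerSeries σ k))) (v i) :=
    fun i => (hv i).ringHom_of_comp_eq hX.aevalEquiv (RingHom.id (MvPowerSeries σ k))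
      hX.aevalEquiv.injective (RingHom.ext fun p => by
        simp only [RingHom.comp_apply, RingHom.coe_coe, RingHom.id_apply,
          algebraMap_mvPolynomial_apply]
        rw [hX.algebraMap_aevalEquiv, aeval_X_eq_coe])
  -- Each `X i` is algebraic over `k[v]`. Substituting `w` turns `v j` into `X j` and `X i` into `w
  -- i`.
  have h := (isAlgebraic_adjoin_range_of_algebraicIndependent hX hindep hvX i).ringHom_of_comp_eq
    (S := MvPolynomial σ k) hindep.aevalEquiv.symm (substAlgHom hw₀)
    hindep.aevalEquiv.symm.injective (RingHom.ext fun a => by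
      obtain ⟨p, rfl⟩ := hindep.aevalEquiv.surjective a
      simp only [RingHom.comp_apply, RingHom.coe_coe, algebraMap_mvPolynomial_apply,
        AlgEquiv.symm_apply_apply]
      rw [hindep.algebraMap_aevalEquiv, coe_substAlgHom, hinv])
  rwa [substAlgHom_X] at h

/-- The implicit function theorem for algebraic power series. -/
theorem isAlgebraic_of_substRight_eq (hF : ∀ i, constantCoeff (F i) = 0)
    (hF' : ∀ i j, constantCoeff (pderiv k (Sum.inr j) (F i)) = 0)
    (halg : ∀ i, IsAlgebraic (MvPolynomial (σ ⊕ τ) k) (F i)) {Ψ : τ → MvPowerSeries σ k}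
    (hΨ₀ : ∀ i, constantCoeff (Ψ i) = 0) (hΨ : substRight F Ψ = Ψ) (i : τ) :
    IsAlgebraic (MvPolynomial σ k) (Ψ i) := by
  let e : σ ⊕ τ ↪ (σ ⊕ τ) ⊕ τ :=
    ⟨Sum.map Sum.inl id, Function.Injective.sumMap Sum.inl_injective Function.injective_id⟩
  -- Solve the deformed equation `y = t + F(x, y)` by `y = Θ(x, t)`. Then `(x, t) ↦ (x, Θ)` is a
  -- right inverse of the algebraic map `(x, y) ↦ (x, y - F(x, y))`, and `Ψ` is recovered at `t =
  -- 0`.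
  let G : τ → MvPowerSeries ((σ ⊕ τ) ⊕ τ) k := fun i => X (Sum.inl (Sum.inr i)) + rename e (F i)
  have hG : ∀ i, constantCoeff (G i) = 0 := fun i => by simp [G, hF]
  have hG' : ∀ i j, constantCoeff (pderiv k (Sum.inr j) (G i)) = 0 := fun i j => by
    have h : pderiv k (Sum.inr j) (rename e (F i)) = rename e (pderiv k (Sum.inr j) (F i)) :=
      pderiv_rename e (Sum.inr j) (F i)
    simp [G, h, hF']
  obtain ⟨Θ, hΘ₀, hΘ, -⟩ := exists_fixedPoint_substRight hG hG'
  have hΘ' : ∀ i, Θ i = X (Sum.inr i) +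
      (F i).subst (Sum.elim (fun j => X (Sum.inl j)) Θ : σ ⊕ τ → MvPowerSeries (σ ⊕ τ) k) := by
    intro i
    have hs := hasSubst_sumElim_X hΘ₀
    conv_lhs => rw [← congrFun hΘ i]
    rw [substRight, subst_add hs, subst_X hs, subst_rename _ hs]
    congr 2
    funext j
    rcases j with j | j <;> rfl
  let v : σ ⊕ τ → MvPowerSeries (σ ⊕ τ) k :=
    Sum.elim (fun j => X (Sum.inl j)) fun i => X (Sum.inr i) - F i
  let w : σ ⊕ τ → MvPowerSeries (σ ⊕ τ) k := Sum.elim (fun j => X (Sum.inl j)) Θ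
  have hv : HasSubst v := hasSubst_of_constantCoeff_zero (by rintro (j | j) <;> simp [v, hF])
  have hw : HasSubst w := hasSubst_of_constantCoeff_zero (by rintro (j | j) <;> simp [w, hΘ₀])
  have hX : ∀ j, IsAlgebraic (MvPolynomial (σ ⊕ τ) k) (X j : MvPowerSeries (σ ⊕ τ) k) :=
    fun j => by
      have := isAlgebraic_algebraMap (A := MvPowerSeries (σ ⊕ τ) k)
        (MvPolynomial.X j : MvPolynomial (σ ⊕ τ) k)
      rwa [algebraMap_mvPolynomial_apply, MvPolynomial.coe_X] at this
  have hΘalg : IsAlgebraic (MvPolynomial (σ ⊕ τ) k) (Θ i) := by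
    refine isAlgebraic_of_subst_eq_X hv hw ?_ ?_ (Sum.inr i)
    · rintro (j | j)
      · exact hX _
      · exact (hX _).sub (halg j)
    · rintro (j | j)
      · exact subst_X hw _
      · simp only [v, Sum.elim_inr]
        rw [subst_sub hw, subst_X hw]
        simp only [w, Sum.elim_inr]
        rw [hΘ' j, add_sub_cancel_right]
  have hz : HasSubst (Sum.elim X 0 : σ ⊕ τ → MvPowerSeries σ k) :=
    hasSubst_sumElim_X (fun i => by simp)
  have hκ₀ : ∀ i, constantCoeff (killCompl Function.Embedding.inl (Θ i)) = 0 := fun i => by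
    rw [← coeff_zero_eq_constantCoeff_apply, coeff_killCompl, Finsupp.embDomain_zero,
      coeff_zero_eq_constantCoeff_apply, hΘ₀]
  have hκ : substRight F (fun i => killCompl Function.Embedding.inl (Θ i)) =
      fun i => killCompl Function.Embedding.inl (Θ i) := by
    funext i
    rw [killCompl_inl_eq_subst, hΘ' i, subst_add hz, subst_X hz, subst_comp_subst_apply hw hz,
      substRight]
    simp only [Sum.elim_inr, Pi.zero_apply, zero_add]
    congr 1
    funext j
    rcases j with j | j
    · simp [w, subst_X hz]
    · simp [w, killCompl_inl_eq_subst]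
  rw [fixedPoint_substRight_unique hF' hΨ₀ hΨ hκ₀ hκ]
  exact isAlgebraic_killCompl_inl hΘalg

end AlgebraicImplicit

end MvPowerSeries

end

/-! ### Formal, convergent and algebraic series as instances of one notion. -/

noncomputable section

namespace FormalCR

open MvPowerSeries

/-- A class of formal power series over `ℂ` in finitely many variables that is closed under the
operations of differential algebra and under the implicit function theorem. -/
structure SeriesClass where
  /-- The series of the class in given variables. -/
  carrier : ∀ σ : Type, Subalgebra ℂ (MvPowerSeries σ ℂ)
  X_mem : ∀ {σ : Type} (i : σ), X i ∈ carrier σ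
  pderiv_mem : ∀ {σ : Type} {f : MvPowerSeries σ ℂ} (i : σ),
    f ∈ carrier σ → pderiv ℂ i f ∈ carrier σ
  rename_mem : ∀ {σ τ : Type} [Finite σ] [Finite τ] {f : MvPowerSeries σ ℂ} (e : σ ↪ τ),
    f ∈ carrier σ → rename e f ∈ carrier τ
  bar_mem : ∀ {σ : Type} {f : MvPowerSeries σ ℂ}, f ∈ carrier σ → bar f ∈ carrier σ
  implicit_mem : ∀ {σ τ : Type} [Finite σ] [Finite τ] {F : τ → MvPowerSeries (σ ⊕ τ) ℂ},
    (∀ i, constantCoeff (F i) = 0) →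
    (∀ i j, constantCoeff (pderiv ℂ (Sum.inr j) (F i)) = 0) →
    (∀ i, F i ∈ carrier (σ ⊕ τ)) → ∀ {Ψ : τ → MvPowerSeries σ ℂ},
    (∀ i, constantCoeff (Ψ i) = 0) → substRight F Ψ = Ψ → ∀ i, Ψ i ∈ carrier σ

/-- The class of all formal power series. -/
def SeriesClass.formal : SeriesClass where
  carrier _ := ⊤
  X_mem _ := trivial
  pderiv_mem _ _ := trivial
  rename_mem _ _ := trivial
  bar_mem _ := trivial
  implicit_mem _ _ _ _ _ _ _ := trivial

/-- The convergent power series. -/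
def convergentSeries (σ : Type) : Subalgebra ℂ (MvPowerSeries σ ℂ) where
  carrier := {f | IsConvergent f}
  mul_mem' := IsConvergent.mul
  add_mem' := IsConvergent.add
  algebraMap_mem' c := isConvergent_C c

/-- The class of convergent power series. -/
def SeriesClass.convergent : SeriesClass where
  carrier := convergentSeries
  X_mem := isConvergent_X
  pderiv_mem i hf := IsConvergent.pderiv hf i
  rename_mem e hf := IsConvergent.rename hf e
  bar_mem := IsConvergent.bar
  implicit_mem hF hF' h _ hΨ₀ hΨ := IsConvergent.of_substRight_eq hF hF' h hΨ₀ hΨ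

/-- The algebraic power series. -/
def algebraicSeries (σ : Type) : Subalgebra ℂ (MvPowerSeries σ ℂ) where
  carrier := {f | IsAlgebraicSeries f}
  mul_mem' hf hg := ⟨hf.1.mul hg.1, hf.2.mul hg.2⟩
  add_mem' hf hg := ⟨hf.1.add hg.1, hf.2.add hg.2⟩
  algebraMap_mem' c := ⟨isConvergent_C c, by
    have := isAlgebraic_algebraMap (A := MvPowerSeries σ ℂ) (MvPolynomial.C c : MvPolynomial σ ℂ)
    rwa [algebraMap_mvPolynomial_apply, MvPolynomial.coe_C] at this⟩

/-- The class of algebraic power series. -/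
def SeriesClass.algebraic : SeriesClass where
  carrier := algebraicSeries
  X_mem {σ} i := ⟨isConvergent_X i, by
    have := isAlgebraic_algebraMap (A := MvPowerSeries σ ℂ) (MvPolynomial.X i : MvPolynomial σ ℂ)
    rwa [algebraMap_mvPolynomial_apply, MvPolynomial.coe_X] at this⟩
  pderiv_mem i hf := ⟨hf.1.pderiv i, isAlgebraic_pderiv hf.2 i⟩
  rename_mem e hf := ⟨hf.1.rename e, isAlgebraic_rename hf.2 e⟩
  bar_mem hf := ⟨hf.1.bar, isAlgebraic_map hf.2 _⟩
  implicit_mem hF hF' h _ hΨ₀ hΨ i :=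
    ⟨IsConvergent.of_substRight_eq hF hF' (fun i => (h i).1) hΨ₀ hΨ i,
      isAlgebraic_of_substRight_eq hF hF' (fun i => (h i).2) hΨ₀ hΨ i⟩

end FormalCR

end

/-! ### Frames of CR-vector fields. -/

noncomputable section

namespace FormalCR

open MvPowerSeries

section Gradient

variable {N d : ℕ}

theorem pderiv_bar {σ : Type*} (i : σ) (f : MvPowerSeries σ ℂ) :
    pderiv ℂ i (bar f) = bar (pderiv ℂ i f) := by
  ext n
  simp [bar, coeff_pderiv]

theorem constantCoeff_bar {σ : Type*} (f : MvPowerSeries σ ℂ) :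
    constantCoeff (bar f) = starRingEnd ℂ (constantCoeff f) := by
  simp [bar]

/-- The ring automorphism `ρ ↦ ρ̄(ζ, Z)`. -/
def conjSwapHom (N : ℕ) : BiSeries N →+* BiSeries N :=
  ((rename (R := ℂ) Sum.swap : BiSeries N →ₐ[ℂ] BiSeries N) : BiSeries N →+* BiSeries N).comp bar

theorem conjSwapHom_apply (f : BiSeries N) : conjSwapHom N f = conjSwap f := rfl

theorem bar_bar {σ : Type*} (f : MvPowerSeries σ ℂ) : bar (bar f) = f := by
  ext n
  simp [bar]

theorem conjSwap_conjSwap (f : BiSeries N) : conjSwap (conjSwap f) = f := by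
  unfold conjSwap
  rw [show bar (rename Sum.swap (bar f)) = rename Sum.swap (bar (bar f)) from
    (rename_map (f := Sum.swap) (starRingEnd ℂ) (bar f)).symm, bar_bar, rename_rename]
  simp

theorem pderiv_inr_conjSwap (f : BiSeries N) (i : Fin N) :
    pderiv ℂ (Sum.inr i) (conjSwap f) = conjSwap (gradZ f i) := by
  have := pderiv_rename (Equiv.sumComm (Fin N) (Fin N)).toEmbedding (Sum.inl i) (bar f)
  unfold conjSwap gradZ
  rw [← pderiv_bar]
  exact this

theorem constantCoeff_conjSwap (f : BiSeries N) :
    constantCoeff (conjSwap f) = starRingEnd ℂ (constantCoeff f) := by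
  simp [conjSwap, constantCoeff_bar]

variable (M : FormalGenericSubmanifold N d)

theorem FormalGenericSubmanifold.constantCoeff_eq_zero {f : BiSeries N} (hf : f ∈ M.ideal) :
    constantCoeff f = 0 := by
  obtain ⟨ρ, hρ, h₀, -⟩ := M.exists_generators
  rw [← hρ] at hf
  have : Ideal.span (Set.range ρ) ≤ RingHom.ker (constantCoeff (σ := Fin N ⊕ Fin N) (R := ℂ)) := by
    rw [Ideal.span_le]
    rintro _ ⟨j, rfl⟩
    exact h₀ j
  exact this hf

theorem FormalGenericSubmanifold.conjSwap_mem {f : BiSeries N} (hf : f ∈ M.ideal) :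
    conjSwap f ∈ M.ideal := by
  obtain ⟨ρ, hρ, -, h, -⟩ := M.exists_generators
  have : Ideal.span (Set.range ρ) ≤ M.ideal.comap (conjSwapHom N) := by
    rw [Ideal.span_le]
    rintro _ ⟨j, rfl⟩
    exact h j
  exact this (hρ ▸ hf)

/-- The ideal is stable under the involution `conjSwap`. The new generators have `ζ`-gradients that
are conjugates of the `Z`-gradients, hence of full rank at the origin. -/
theorem FormalGenericSubmanifold.span_conjSwap {ρ : Fin d → BiSeries N} (hρ : M.IsGenerators ρ) :
    Ideal.span (Set.range fun j => conjSwap (ρ j)) = M.ideal := by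
  have hmem : ∀ j, ρ j ∈ M.ideal := fun j => hρ ▸ Ideal.subset_span ⟨j, rfl⟩
  apply le_antisymm
  · rw [Ideal.span_le]
    rintro _ ⟨j, rfl⟩
    exact M.conjSwap_mem (hmem j)
  · intro f hf
    have : M.ideal ≤ (Ideal.span (Set.range fun j => conjSwap (ρ j))).comap (conjSwapHom N) := by
      rw [← hρ, Ideal.span_le]
      rintro _ ⟨j, rfl⟩
      exact Ideal.subset_span ⟨j, rfl⟩
    have h := this (M.conjSwap_mem hf)
    rwa [Ideal.mem_comap, conjSwapHom_apply, conjSwap_conjSwap] at h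

theorem exists_matrix_mul_eq_one_of_linearIndependent {k : Type*} [Field k] {m n : Type*}
    [Fintype m] [Fintype n] [DecidableEq m] {v : m → n → k} (hv : LinearIndependent k v) :
    ∃ B : Matrix n m k, Matrix.of v * B = 1 := by
  classical
  obtain ⟨g, hg⟩ := LinearMap.exists_leftInverse_of_injective (Fintype.linearCombination k v)
    (LinearMap.ker_eq_bot.mpr hv.fintypeLinearCombination_injective)
  refine ⟨Matrix.of fun i => g (Pi.single i 1), ?_⟩
  ext j l
  have h := congrFun (LinearMap.congr_fun hg (Pi.single j 1)) l
  rw [LinearMap.comp_apply, Fintype.linearCombination_apply_single, one_smul,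
    LinearMap.id_apply] at h
  have hδ : (1 : Matrix m m k) j l = (Pi.single j 1 : m → k) l := by
    simp [Matrix.one_apply, Pi.single_apply, eq_comm]
  rw [hδ, ← h, Matrix.mul_apply]
  conv_rhs => rw [pi_eq_sum_univ' (v j), map_sum, Finset.sum_apply]
  refine Finset.sum_congr rfl fun i _ => ?_
  rw [map_smul, Pi.smul_apply, smul_eq_mul]
  rfl

/-- The gradients at the origin of any `d` generators of the ideal are independent. -/
theorem FormalGenericSubmanifold.exists_gradZ_mul_eq_one {ρ : Fin d → BiSeries N}
    (hρ : M.IsGenerators ρ) :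
    ∃ B : Matrix (Fin N) (Fin d) ℂ,
      (Matrix.of fun j i => constantCoeff (gradZ (ρ j) i)) * B = 1 := by
  obtain ⟨ρ₀, hρ₀, -, -, hlin⟩ := M.exists_generators
  obtain ⟨B₀, hB₀⟩ := exists_matrix_mul_eq_one_of_linearIndependent hlin
  have hmem : ∀ j, ρ j ∈ M.ideal := fun j => hρ ▸ Ideal.subset_span ⟨j, rfl⟩
  have hex : ∀ j, ∃ c : Fin d → BiSeries N, ∑ l, c l * ρ l = ρ₀ j := fun j =>
    Ideal.mem_span_range_iff_exists_fun.mp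
      (show ρ₀ j ∈ Ideal.span (Set.range ρ) by
        rw [show Ideal.span (Set.range ρ) = M.ideal from hρ, ← hρ₀]
        exact Ideal.subset_span ⟨j, rfl⟩)
  choose c hc using hex
  let A : Matrix (Fin d) (Fin d) ℂ := Matrix.of fun j l => constantCoeff (c j l)
  let G : Matrix (Fin d) (Fin N) ℂ := Matrix.of fun j i => constantCoeff (gradZ (ρ j) i)
  -- In `ρ₀ = ∑ c ρ` the derivatives of `c` are multiplied by `ρ`, which vanishes at the origin.
  have hAG : Matrix.of (fun j => evalZero N (gradZ (ρ₀ j))) = A * G := by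
    ext j i
    rw [Matrix.mul_apply]
    change constantCoeff (gradZ (ρ₀ j) i) = _
    rw [← hc j, gradZ, map_sum, map_sum]
    refine Finset.sum_congr rfl fun l _ => ?_
    simp [Derivation.leibniz, M.constantCoeff_eq_zero (hmem l), A, G, gradZ]
  rw [hAG, Matrix.mul_assoc] at hB₀
  refine ⟨B₀ * A, ?_⟩
  rw [← Matrix.mul_assoc]
  -- The matrices `A` and `G * B₀` are square, so the one-sided inverse is two-sided.
  exact mul_eq_one_comm.mp hB₀

end Gradient

section VectorFields

variable {N d : ℕ}

theorem vf01_add (b : Fin N → BiSeries N) (f g : BiSeries N) :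
    vf01 b (f + g) = vf01 b f + vf01 b g := by
  simp [vf01, mul_add, Finset.sum_add_distrib]

theorem vf01_mul (b : Fin N → BiSeries N) (f g : BiSeries N) :
    vf01 b (f * g) = f * vf01 b g + vf01 b f * g := by
  simp only [vf01, Derivation.leibniz, smul_eq_mul, Finset.mul_sum, Finset.sum_mul]
  rw [← Finset.sum_add_distrib]
  exact Finset.sum_congr rfl fun j _ => by ring

theorem vf01_zero (b : Fin N → BiSeries N) : vf01 b 0 = 0 := by
  simp [vf01]

theorem _root_.Matrix.det_mem_subalgebra {k R n : Type*} [CommRing k] [CommRing R] [Algebra k R]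
    [Fintype n] [DecidableEq n] (S : Subalgebra k R) {A : Matrix n n R}
    (hA : ∀ i j, A i j ∈ S) : A.det ∈ S := by
  rw [Matrix.det_apply]
  exact sum_mem fun σ _ => Subalgebra.zsmul_mem _ (prod_mem fun i _ => hA _ _) _

theorem _root_.Matrix.adjugate_mem_subalgebra {k R n : Type*} [CommRing k] [CommRing R]
    [Algebra k R] [Fintype n] [DecidableEq n] (S : Subalgebra k R) {A : Matrix n n R}
    (hA : ∀ i j, A i j ∈ S) (i j : n) : A.adjugate i j ∈ S := by
  rw [Matrix.adjugate_apply]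
  refine Matrix.det_mem_subalgebra S fun a b => ?_
  rw [Matrix.updateRow_apply]
  split_ifs
  · rw [Pi.single_apply]
    split_ifs
    exacts [one_mem _, zero_mem _]
  · exact hA a b

/-- With `K = J * P`, the matrix `T = det K - P adj(K) J` is `det K` times the projection onto the
kernel of `J` along the image of `P`. Using the adjugate in place of the inverse keeps its entries
in `S`; the coefficients `c` need not lie there. -/
theorem _root_.Matrix.exists_mulVec_kernel_frame {k R m n : Type*} [CommRing k] [CommRing R]
    [Algebra k R] [Fintype m] [DecidableEq m] [Fintype n] [DecidableEq n] (S : Subalgebra k R)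
    {J : Matrix m n R} {P : Matrix n m R} (hJ : ∀ j i, J j i ∈ S) (hP : ∀ i j, P i j ∈ S)
    (hK : IsUnit (J * P).det) :
    ∃ Q : n → n → R, (∀ a i, Q a i ∈ S) ∧ (∀ a, J.mulVec (Q a) = 0) ∧
      ∀ (I : Ideal R) (b : n → R), (∀ j, J.mulVec b j ∈ I) →
        ∃ c : n → R, ∀ i, b i - ∑ a, c a * Q a i ∈ I := by
  have hKS : ∀ i j, (J * P) i j ∈ S := fun i j => by
    rw [Matrix.mul_apply]
    exact sum_mem fun l _ => mul_mem (hJ _ _) (hP _ _)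
  obtain ⟨T, hT⟩ : ∃ T, T = (J * P).det • (1 : Matrix n n R) - P * (J * P).adjugate * J := ⟨_, rfl⟩
  have hJT : J * T = 0 := by
    rw [hT, Matrix.mul_sub, Matrix.mul_smul, Matrix.mul_one, ← Matrix.mul_assoc,
      ← Matrix.mul_assoc, Matrix.mul_adjugate, Matrix.smul_mul, Matrix.one_mul, sub_self]
  refine ⟨fun a i => T i a, fun a i => ?_, fun a => ?_, fun I b hb => ?_⟩
  · change T i a ∈ S
    rw [hT, Matrix.sub_apply, Matrix.smul_apply, smul_eq_mul, Matrix.mul_apply]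
    refine sub_mem (mul_mem (Matrix.det_mem_subalgebra _ hKS) ?_) ?_
    · rw [Matrix.one_apply]
      split_ifs
      exacts [one_mem _, zero_mem _]
    · refine sum_mem fun l _ => mul_mem ?_ (hJ _ _)
      rw [Matrix.mul_apply]
      exact sum_mem fun m _ => mul_mem (hP _ _) (Matrix.adjugate_mem_subalgebra _ hKS _ _)
  · funext j
    exact congrFun (congrFun hJT j) a
  · obtain ⟨u, hu⟩ := hK
    refine ⟨fun a => (↑u⁻¹ : R) * b a, fun i => ?_⟩
    have hTb : T.mulVec b i =
        (J * P).det * b i - ((P * (J * P).adjugate).mulVec (J.mulVec b)) i := by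
      rw [hT, Matrix.sub_mulVec, Matrix.smul_mulVec, Matrix.one_mulVec, Matrix.mulVec_mulVec]
      rfl
    have hsum : ∑ a, (↑u⁻¹ : R) * b a * T i a = ↑u⁻¹ * T.mulVec b i := by
      rw [Matrix.mulVec, dotProduct, Finset.mul_sum]
      exact Finset.sum_congr rfl fun a _ => by ring
    rw [hsum, hTb, ← hu, mul_sub, Units.inv_mul_cancel_left, sub_sub_cancel]
    exact Ideal.mul_mem_left _ _ (sum_mem fun j _ => Ideal.mul_mem_left _ _ (hb j))

theorem mulVec_pderiv_eq_vf01 {m : Type*} (σ : m → BiSeries N) (b : Fin N → BiSeries N) (j : m) :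
    (Matrix.of fun j i => pderiv ℂ (Sum.inr i) (σ j)).mulVec b j = vf01 b (σ j) := by
  rw [Matrix.mulVec, dotProduct, vf01]
  exact Finset.sum_congr rfl fun _ _ => mul_comm _ _

theorem FormalGenericSubmanifold.isCRVectorField_of_generators (M : FormalGenericSubmanifold N d)
    {m : Type*} [Fintype m] {σ : m → BiSeries N} (hσ : Ideal.span (Set.range σ) = M.ideal)
    {b : Fin N → BiSeries N} (hb : ∀ j, vf01 b (σ j) = 0) : M.IsCRVectorField b := by
  intro f hf
  rw [← hσ] at hf
  obtain ⟨c, rfl⟩ := Ideal.mem_span_range_iff_exists_fun.mp hf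
  have : vf01 b (∑ j, c j * σ j) = ∑ j, vf01 b (c j) * σ j := by
    rw [← AddMonoidHom.mk'_apply (vf01 b) (vf01_add b), map_sum]
    refine Finset.sum_congr rfl fun j _ => ?_
    rw [AddMonoidHom.mk'_apply, vf01_mul, hb, mul_zero, zero_add]
  rw [this]
  exact sum_mem fun j _ => Ideal.mul_mem_left _ _ (hσ ▸ Ideal.subset_span ⟨j, rfl⟩)

/-- If the ideal of `M` has generators in a class of series, then there are CR-vector fields with
coefficients in this class that span all CR-vector fields modulo the ideal. -/
theorem FormalGenericSubmanifold.exists_frame (M : FormalGenericSubmanifold N d) (𝒞 : SeriesClass)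
    {ρ : Fin d → BiSeries N} (hρ : M.IsGenerators ρ) (hρ𝒞 : ∀ j, ρ j ∈ 𝒞.carrier _) :
    ∃ Q : Fin N → Fin N → BiSeries N, (∀ a i, Q a i ∈ 𝒞.carrier _) ∧
      (∀ a, M.IsCRVectorField (Q a)) ∧
      ∀ b, M.IsCRVectorField b →
        ∃ c : Fin N → BiSeries N, ∀ i, b i - ∑ a, c a * Q a i ∈ M.ideal := by
  obtain ⟨B, hB⟩ := M.exists_gradZ_mul_eq_one hρ
  let σ : Fin d → BiSeries N := fun j => conjSwap (ρ j)
  have hσ : Ideal.span (Set.range σ) = M.ideal := M.span_conjSwap hρ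
  have hσmem : ∀ j, σ j ∈ M.ideal := fun j => hσ ▸ Ideal.subset_span ⟨j, rfl⟩
  have hσ𝒞 : ∀ j, σ j ∈ 𝒞.carrier _ := fun j =>
    𝒞.rename_mem (Equiv.sumComm (Fin N) (Fin N)).toEmbedding (𝒞.bar_mem (hρ𝒞 j))
  obtain ⟨Q, hQ𝒞, hQ, hspan⟩ := Matrix.exists_mulVec_kernel_frame (𝒞.carrier (Fin N ⊕ Fin N))
    (J := Matrix.of fun j i => pderiv ℂ (Sum.inr i) (σ j))
    -- The conjugate of `B` is a right inverse at the origin of the `ζ`-Jacobian of the conjugated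
    -- generators, so the determinant has constant term 1.
    (P := Matrix.of fun i j => C (starRingEnd ℂ (B i j)))
    (fun j i => 𝒞.pderiv_mem _ (hσ𝒞 j)) (fun i j => Subalgebra.algebraMap_mem _ _) (by
      rw [MvPowerSeries.isUnit_iff_constantCoeff, RingHom.map_det, RingHom.mapMatrix_apply,
        Matrix.map_mul]
      have h := congrArg (fun A => Matrix.map A (starRingEnd ℂ)) hB
      simp only [Matrix.map_mul] at h
      rw [Matrix.map_one _ (map_zero _) (map_one _)] at h
      convert isUnit_one
      rw [← Matrix.det_one (n := Fin d), ← h]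
      congr 2
      · ext j i
        simp only [Matrix.map_apply, Matrix.of_apply, σ]
        rw [pderiv_inr_conjSwap, constantCoeff_conjSwap])
  refine ⟨Q, hQ𝒞, fun a => M.isCRVectorField_of_generators hσ fun j => ?_, fun b hb =>
    hspan M.ideal b fun j => ?_⟩
  · rw [← mulVec_pderiv_eq_vf01, hQ, Pi.zero_apply]
  · rw [mulVec_pderiv_eq_vf01]
    exact hb _ (hσmem j)

end VectorFields

end FormalCR

end

/-! ### Reduction of iterated CR-derivatives to the frame. -/

noncomputable section

namespace FormalCR

open MvPowerSeries

section FrameSpan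

variable {N N' d d' : ℕ}

/-- The span of the vectors `Q_{w_1} ⋯ Q_{w_r} ρ'_{j,Z'}(H(Z), H̄(ζ))` for words `w` of length at
most `k` in the vector fields `Q_a`, together with the vectors with entries in the ideal of `M`. -/
def frameSubmodule (M : FormalGenericSubmanifold N d) (H : FormalMap N N')
    (Q : Fin N → Fin N → BiSeries N) (ρ' : Fin d' → BiSeries N') (k : ℕ) :
    Submodule (BiSeries N) (Fin N' → BiSeries N) :=
  Submodule.span (BiSeries N)
    {v | ∃ w : List (Fin N), w.length ≤ k ∧
      ∃ j, v = fun i => vf01List (w.map Q) (H.pullback (gradZ (ρ' j) i))} ⊔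
    Submodule.pi Set.univ fun _ => M.ideal

theorem frameSubmodule_mono (M : FormalGenericSubmanifold N d) (H : FormalMap N N')
    (Q : Fin N → Fin N → BiSeries N) (ρ' : Fin d' → BiSeries N') {k l : ℕ} (hkl : k ≤ l) :
    frameSubmodule M H Q ρ' k ≤ frameSubmodule M H Q ρ' l := by
  refine sup_le_sup_right (Submodule.span_mono ?_) _
  rintro v ⟨w, hw, h⟩
  exact ⟨w, hw.trans hkl, h⟩

/-- Modulo `I`, `L` is a combination of the `Q a`, and the Leibniz rule handles series coefficients.
The error terms have entries in `I`, which CR-vector fields preserve; this is why `frameSubmodule`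
contains such vectors. -/
theorem vf01_mem_frameSubmodule {M : FormalGenericSubmanifold N d} {H : FormalMap N N'}
    {Q : Fin N → Fin N → BiSeries N} (hQ : ∀ b, M.IsCRVectorField b →
      ∃ c : Fin N → BiSeries N, ∀ i, b i - ∑ a, c a * Q a i ∈ M.ideal)
    {ρ' : Fin d' → BiSeries N'} {k : ℕ} {L : Fin N → BiSeries N} (hL : M.IsCRVectorField L)
    {v : Fin N' → BiSeries N} (hv : v ∈ frameSubmodule M H Q ρ' k) :
    (fun i => vf01 L (v i)) ∈ frameSubmodule M H Q ρ' (k + 1) := by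
  obtain ⟨s, hs, t, ht, rfl⟩ := Submodule.mem_sup.mp hv
  have hsplit : (fun i => vf01 L ((s + t) i)) =
      (fun i => vf01 L (s i)) + fun i => vf01 L (t i) := by
    funext i
    exact vf01_add L _ _
  rw [hsplit]
  refine add_mem ?_ (Submodule.mem_sup_right fun i hi => hL _ (ht i hi))
  clear hv hsplit
  induction hs using Submodule.span_induction with
  | mem v hv =>
    obtain ⟨w, hw, j, rfl⟩ := hv
    obtain ⟨c, hc⟩ := hQ L hL
    have h : (fun i => vf01 L (vf01List (w.map Q) (H.pullback (gradZ (ρ' j) i)))) =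
        (∑ a, c a • fun i => vf01List ((a :: w).map Q) (H.pullback (gradZ (ρ' j) i))) +
          fun i => ∑ l, (L l - ∑ a, c a * Q a l) *
            pderiv ℂ (Sum.inr l) (vf01List (w.map Q) (H.pullback (gradZ (ρ' j) i))) := by
      funext i
      simp only [Pi.add_apply, Finset.sum_apply, Pi.smul_apply, smul_eq_mul, List.map_cons,
        vf01List, List.foldr_cons, vf01, sub_mul, Finset.sum_sub_distrib, Finset.mul_sum,
        Finset.sum_mul]
      rw [Finset.sum_comm (s := Finset.univ (α := Fin N))]
      simp only [mul_assoc, add_sub_cancel]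
    rw [h]
    refine add_mem (sum_mem fun a _ => Submodule.smul_mem _ _ (Submodule.mem_sup_left
      (Submodule.subset_span ⟨a :: w, by simpa using hw, j, rfl⟩))) ?_
    exact Submodule.mem_sup_right fun i _ => sum_mem fun l _ => Ideal.mul_mem_right _ _ (hc l)
  | zero =>
    have h : (fun i => vf01 L ((0 : Fin N' → BiSeries N) i)) = 0 := by
      funext i
      exact vf01_zero L
    rw [h]
    exact zero_mem _
  | add x y _ _ hx hy =>
    have h : (fun i => vf01 L ((x + y) i)) = (fun i => vf01 L (x i)) + fun i => vf01 L (y i) := by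
      funext i
      exact vf01_add L _ _
    rw [h]
    exact add_mem hx hy
  | smul c x hx ih =>
    have h : (fun i => vf01 L ((c • x) i)) = c • (fun i => vf01 L (x i)) + vf01 L c • x := by
      funext i
      exact vf01_mul L _ _
    rw [h]
    exact add_mem (Submodule.smul_mem _ _ ih) (Submodule.smul_mem _ _
      (frameSubmodule_mono M H Q ρ' k.le_succ (Submodule.mem_sup_left hx)))

/-- This also changes generators, since nondegeneracy is witnessed by some `ρ₁` while regularity
concerns other ones. For `ρ₁ = ∑ c ρ₂` the terms with the gradient of `c` carry the pullback of
`ρ₂`, which lies in `I`. -/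
theorem degSubmodule_le_frameSubmodule {M : FormalGenericSubmanifold N d}
    {M' : FormalGenericSubmanifold N' d'} {H : FormalMap N N'} (hH : H.MapsInto M M')
    {Q : Fin N → Fin N → BiSeries N} (hQ : ∀ b, M.IsCRVectorField b →
      ∃ c : Fin N → BiSeries N, ∀ i, b i - ∑ a, c a * Q a i ∈ M.ideal)
    {ρ₁ ρ₂ : Fin d' → BiSeries N'} (h₁ : M'.IsGenerators ρ₁) (h₂ : M'.IsGenerators ρ₂) (k : ℕ) :
    degSubmodule M H ρ₁ k ≤ frameSubmodule M H Q ρ₂ k := by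
  refine Submodule.span_le.mpr ?_
  rintro v ⟨Ls, hLs, hk, j, rfl⟩
  refine frameSubmodule_mono M H Q ρ₂ hk ?_
  clear hk
  induction Ls with
  | nil =>
    have hmem : ρ₁ j ∈ Ideal.span (Set.range ρ₂) := by
      rw [show Ideal.span (Set.range ρ₂) = M'.ideal from h₂, ← show _ = M'.ideal from h₁]
      exact Ideal.subset_span ⟨j, rfl⟩
    obtain ⟨c, hc⟩ := Ideal.mem_span_range_iff_exists_fun.mp hmem
    have hs := H.hasSubst_pair
    have h : (fun i => vf01List [] (H.pullback (gradZ (ρ₁ j) i))) =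
        (∑ l, H.pullback (c l) • fun i =>
          vf01List (([] : List (Fin N)).map Q) (H.pullback (gradZ (ρ₂ l) i))) +
        fun i => ∑ l, H.pullback (gradZ (c l) i) * H.pullback (ρ₂ l) := by
      funext i
      simp only [Pi.add_apply, Finset.sum_apply, Pi.smul_apply, smul_eq_mul, vf01List,
        List.map_nil, List.foldr_nil, gradZ, FormalMap.pullback, ← hc, map_sum,
        Derivation.leibniz, subst_sum hs, subst_add hs, subst_mul hs, Finset.sum_add_distrib]
      congr 1
      exact Finset.sum_congr rfl fun l _ => mul_comm _ _
    rw [h]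
    refine add_mem (sum_mem fun l _ => Submodule.smul_mem _ _ (Submodule.mem_sup_left
      (Submodule.subset_span ⟨[], le_rfl, l, rfl⟩))) ?_
    exact Submodule.mem_sup_right fun i _ => sum_mem fun l _ =>
      Ideal.mul_mem_left _ _ (hH _ (h₂ ▸ Ideal.subset_span ⟨l, rfl⟩))
  | cons L Ls ih =>
    exact vf01_mem_frameSubmodule hQ (hLs L (by simp)) (ih fun L' hL' => hLs L' (by simp [hL']))

end FrameSpan

end FormalCR

end

/-! ### Prolongation to jet space. -/

noncomputable section

namespace FormalCR

open MvPowerSeries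

section MultiDeriv

theorem pderiv_comm {σ R : Type*} [CommSemiring R] (i j : σ) (f : MvPowerSeries σ R) :
    pderiv R i (pderiv R j f) = pderiv R j (pderiv R i f) := by
  classical
  rcases eq_or_ne i j with rfl | h
  · rfl
  ext n
  simp only [coeff_pderiv, Finsupp.add_apply, Finsupp.single_eq_of_ne h,
    Finsupp.single_eq_of_ne h.symm, add_zero]
  rw [add_right_comm]
  ring

variable {N : ℕ}

theorem multiDeriv_zero (f : MvPowerSeries (Fin N) ℂ) : multiDeriv 0 f = f := by
  unfold multiDeriv
  induction List.finRange N with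
  | nil => rfl
  | cons i l ih => exact ih

theorem pderiv_multiDeriv (i : Fin N) (β : Fin N →₀ ℕ) (f : MvPowerSeries (Fin N) ℂ) :
    pderiv ℂ i (multiDeriv β f) = multiDeriv (β + Finsupp.single i 1) f := by
  have comm : ∀ j k : Fin N, ∀ n, ∀ g : MvPowerSeries (Fin N) ℂ,
      pderiv ℂ j ((pderiv ℂ k)^[n] g) = (pderiv ℂ k)^[n] (pderiv ℂ j g) := fun j k n =>
    (show Function.Commute (pderiv ℂ j) (pderiv ℂ k) from pderiv_comm j k).iterate_right n
  have hnot : ∀ l : List (Fin N), i ∉ l →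
      l.foldr (fun j g => (pderiv ℂ j)^[(β + Finsupp.single i 1 : Fin N →₀ ℕ) j] g) f =
        l.foldr (fun j g => (pderiv ℂ j)^[β j] g) f := by
    intro l hl
    induction l with
    | nil => rfl
    | cons j l ih =>
      rw [List.mem_cons, not_or] at hl
      rw [List.foldr_cons, List.foldr_cons, ih hl.2, Finsupp.add_apply,
        Finsupp.single_eq_of_ne (Ne.symm hl.1), add_zero]
  have hmem : ∀ l : List (Fin N), l.Nodup → i ∈ l →
      pderiv ℂ i (l.foldr (fun j g => (pderiv ℂ j)^[β j] g) f) =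
        l.foldr (fun j g => (pderiv ℂ j)^[(β + Finsupp.single i 1 : Fin N →₀ ℕ) j] g) f := by
    intro l hl hi
    induction l with
    | nil => simp at hi
    | cons j l ih =>
      rw [List.nodup_cons] at hl
      rw [List.foldr_cons, List.foldr_cons]
      rcases eq_or_ne i j with rfl | h
      · rw [hnot l hl.1, Finsupp.add_apply, Finsupp.single_eq_same, Function.iterate_succ_apply']
      · rw [comm, ih hl.2 ((List.mem_cons.mp hi).resolve_left h), Finsupp.add_apply,
          Finsupp.single_eq_of_ne (Ne.symm h), add_zero]
  exact hmem _ (List.nodup_finRange N) (List.mem_finRange i)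

theorem multiDeriv_bar (β : Fin N →₀ ℕ) (f : MvPowerSeries (Fin N) ℂ) :
    multiDeriv β (bar f) = bar (multiDeriv β f) := by
  unfold multiDeriv
  induction List.finRange N with
  | nil => rfl
  | cons i l ih =>
    rw [List.foldr_cons, List.foldr_cons, ih]
    exact (show Function.Semiconj bar (pderiv ℂ i) (pderiv ℂ i) from
      fun g => (pderiv_bar i g).symm).iterate_right _ _ |>.symm

end MultiDeriv

section Prolongation

variable {N N' : ℕ}

/-- Indices of the variables `(Z, ζ, W, Z')`, where `W` stands for the `r`-jet of a map. -/
abbrev ExtJetVars (N N' r : ℕ) : Type := JetVars N N' r ⊕ Fin N'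

/-- The tuple `(Z, ζ, (∂^β H̄(ζ) - ∂^β H̄(0))_β, H(Z))`. -/
def FormalMap.extJetTuple (r : ℕ) (H : FormalMap N N') : ExtJetVars N N' r → BiSeries N :=
  Sum.elim (H.jetTuple r) fun j => inZ (H.comp j)

theorem FormalMap.constantCoeff_jetTuple (r : ℕ) (H : FormalMap N N') (v : JetVars N N' r) :
    constantCoeff (H.jetTuple r v) = 0 := by
  rcases v with v | v <;> simp [jetTuple, inZeta]

theorem FormalMap.constantCoeff_extJetTuple (r : ℕ) (H : FormalMap N N') (v : ExtJetVars N N' r) :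
    constantCoeff (H.extJetTuple r v) = 0 := by
  rcases v with v | v
  · exact H.constantCoeff_jetTuple r v
  · simp [extJetTuple, inZ, H.map_zero]

theorem FormalMap.hasSubst_extJetTuple (r : ℕ) (H : FormalMap N N') :
    HasSubst (H.extJetTuple r) :=
  hasSubst_of_constantCoeff_zero (H.constantCoeff_extJetTuple r)

/-- A multiindex of order at most `r`, regarded as one of order at most `r + 1`. -/
def MultiIdx.castSucc {r : ℕ} (β : MultiIdx N r) : MultiIdx N (r + 1) :=
  ⟨β.1, β.2.trans r.le_succ⟩

theorem MultiIdx.castSucc_injective {r : ℕ} :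
    Function.Injective (MultiIdx.castSucc : MultiIdx N r → MultiIdx N (r + 1)) :=
  fun _ _ h => Subtype.ext (congrArg (fun β : MultiIdx N (r + 1) => β.1) h)

/-- The multiindex `β + e_i`. -/
def MultiIdx.addSingle {r : ℕ} (i : Fin N) (β : MultiIdx N r) : MultiIdx N (r + 1) :=
  ⟨β.1 + Finsupp.single i 1, by
    rw [map_add, Finsupp.degree_single]
    exact Nat.add_le_add_right β.2 1⟩

/-- The inclusion of the variables for `r`-jets into those for `(r + 1)`-jets. -/
def ExtJetVars.castSucc (N N' r : ℕ) : ExtJetVars N N' r ↪ ExtJetVars N N' (r + 1) :=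
  ⟨Sum.map (Sum.map id (Prod.map MultiIdx.castSucc id)) id,
    Function.Injective.sumMap (Function.Injective.sumMap Function.injective_id
      (Function.Injective.prodMap MultiIdx.castSucc_injective
        Function.injective_id)) Function.injective_id⟩

theorem FormalMap.extJetTuple_comp_castSucc (r : ℕ) (H : FormalMap N N') :
    H.extJetTuple (r + 1) ∘ ExtJetVars.castSucc N N' r = H.extJetTuple r := by
  funext v
  rcases v with (v | v) | v <;> rfl

/-- The total derivative `d/dζ_i` on jet space. -/
def totalDeriv {r : ℕ} (jet : MultiIdx N (r + 1) × Fin N' → ℂ) (i : Fin N)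
    (Φ : MvPowerSeries (ExtJetVars N N' r) ℂ) : MvPowerSeries (ExtJetVars N N' (r + 1)) ℂ :=
  letI := Fintype.ofFinite (MultiIdx N r)
  rename (ExtJetVars.castSucc N N' r) (pderiv ℂ (Sum.inl (Sum.inl (Sum.inr i))) Φ) +
    ∑ p : MultiIdx N r × Fin N',
      rename (ExtJetVars.castSucc N N' r) (pderiv ℂ (Sum.inl (Sum.inr p)) Φ) *
        (X (Sum.inl (Sum.inr (p.1.addSingle i, p.2))) +
          C (starRingEnd ℂ (jet (p.1.addSingle i, p.2))))

/-- The prolongation of the vector field `∑ b_i ∂/∂ζ_i` to jet space. -/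
def prolong {r : ℕ} (jet : MultiIdx N (r + 1) × Fin N' → ℂ) (b : Fin N → BiSeries N)
    (Φ : MvPowerSeries (ExtJetVars N N' r) ℂ) : MvPowerSeries (ExtJetVars N N' (r + 1)) ℂ :=
  ∑ i, rename (fun v => Sum.inl (Sum.inl v)) (b i) * totalDeriv jet i Φ

/-- By the chain rule; `Z'` contributes nothing because `H(Z)` does not depend on `ζ`. -/
theorem subst_totalDeriv {r : ℕ} (H : FormalMap N N') (i : Fin N)
    (Φ : MvPowerSeries (ExtJetVars N N' r) ℂ) :
    (totalDeriv (H.jet (r + 1)) i Φ).subst (H.extJetTuple (r + 1)) =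
      pderiv ℂ (Sum.inr i) (Φ.subst (H.extJetTuple r)) := by
  classical
  let := Fintype.ofFinite (MultiIdx N r)
  have hs := H.hasSubst_extJetTuple (r + 1)
  rw [pderiv_subst (H.hasSubst_extJetTuple r), Fintype.sum_sum_type, Fintype.sum_sum_type,
    Fintype.sum_sum_type, totalDeriv, subst_add hs, subst_sum hs, subst_rename _ hs,
    H.extJetTuple_comp_castSucc]
  have h₁ : ∀ j : Fin N, pderiv ℂ (Sum.inr i)
      (H.extJetTuple r (Sum.inl (Sum.inl (Sum.inl j)))) = 0 := fun j => by
    simp [FormalMap.extJetTuple, FormalMap.jetTuple, pderiv_X_of_ne]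
  have h₂ : ∀ j : Fin N, pderiv ℂ (Sum.inr i)
      (H.extJetTuple r (Sum.inl (Sum.inl (Sum.inr j)))) = if j = i then 1 else 0 := fun j => by
    simp only [FormalMap.extJetTuple, FormalMap.jetTuple, Sum.elim_inl]
    split_ifs with h
    · rw [h, pderiv_X_self]
    · rw [pderiv_X_of_ne (by simpa using h)]
  have h₃ : ∀ j : Fin N', pderiv ℂ (Sum.inr i) (H.extJetTuple r (Sum.inr j)) = 0 := fun j =>
    pderiv_rename_eq_zero Sum.inl (by simp) _
  -- The coordinates `W` are normalised to vanish at the origin, so the next derivative is a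
  -- coordinate plus its conjugated jet value.
  have h₄ : ∀ p : MultiIdx N r × Fin N', pderiv ℂ (Sum.inr i)
      (H.extJetTuple r (Sum.inl (Sum.inr p))) =
        H.extJetTuple (r + 1) (Sum.inl (Sum.inr (p.1.addSingle i, p.2))) +
          C (starRingEnd ℂ (H.jet (r + 1) (p.1.addSingle i, p.2))) := fun p => by
    simp only [FormalMap.extJetTuple, FormalMap.jetTuple, Sum.elim_inl, Sum.elim_inr,
      FormalMap.jet, MultiIdx.addSingle, map_sub, pderiv_C, sub_zero]
    rw [← constantCoeff_bar, ← multiDeriv_bar, sub_add_cancel, ← pderiv_multiDeriv]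
    exact pderiv_rename Function.Embedding.inr i _
  simp only [h₁, h₂, h₃, h₄, mul_zero, Finset.sum_const_zero, zero_add, add_zero, mul_ite, mul_one,
    Finset.sum_ite_eq', Finset.mem_univ, if_true]
  congr 1
  refine Finset.sum_congr rfl fun p _ => ?_
  rw [subst_mul hs, subst_add hs, subst_X hs, subst_C, subst_rename _ hs,
    H.extJetTuple_comp_castSucc]

theorem subst_prolong {r : ℕ} (H : FormalMap N N') (b : Fin N → BiSeries N)
    (Φ : MvPowerSeries (ExtJetVars N N' r) ℂ) :
    (prolong (H.jet (r + 1)) b Φ).subst (H.extJetTuple (r + 1)) =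
      vf01 b (Φ.subst (H.extJetTuple r)) := by
  have hs := H.hasSubst_extJetTuple (r + 1)
  rw [prolong, vf01, subst_sum hs]
  refine Finset.sum_congr rfl fun i _ => ?_
  rw [subst_mul hs, subst_totalDeriv, subst_rename _ hs]
  congr 1
  exact congrFun subst_self _

/-- The coefficients of the total derivative do not involve `Z'`. Hence gradients of iterated
derivatives are iterated derivatives of gradients, as they appear in `E_k`. -/
theorem pderiv_inr_totalDeriv {r : ℕ} (jet : MultiIdx N (r + 1) × Fin N' → ℂ) (i : Fin N)
    (Φ : MvPowerSeries (ExtJetVars N N' r) ℂ) (m : Fin N') :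
    pderiv ℂ (Sum.inr m) (totalDeriv jet i Φ) = totalDeriv jet i (pderiv ℂ (Sum.inr m) Φ) := by
  have h : ∀ g : MvPowerSeries (ExtJetVars N N' r) ℂ,
      pderiv ℂ (Sum.inr m) (rename (ExtJetVars.castSucc N N' r) g) =
        rename (ExtJetVars.castSucc N N' r) (pderiv ℂ (Sum.inr m) g) :=
    pderiv_rename (ExtJetVars.castSucc N N' r) (Sum.inr m)
  simp only [totalDeriv, map_add, map_sum, Derivation.leibniz, h, pderiv_C, smul_eq_mul,
    pderiv_comm (Sum.inr m)]
  congr 1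
  refine Finset.sum_congr rfl fun p _ => ?_
  rw [pderiv_X_of_ne (by simp)]
  ring

theorem pderiv_inr_prolong {r : ℕ} (jet : MultiIdx N (r + 1) × Fin N' → ℂ)
    (b : Fin N → BiSeries N) (Φ : MvPowerSeries (ExtJetVars N N' r) ℂ) (m : Fin N') :
    pderiv ℂ (Sum.inr m) (prolong jet b Φ) = prolong jet b (pderiv ℂ (Sum.inr m) Φ) := by
  simp only [prolong, map_sum, Derivation.leibniz, smul_eq_mul, pderiv_inr_totalDeriv]
  refine Finset.sum_congr rfl fun i _ => ?_
  rw [pderiv_rename_eq_zero _ (by simp), mul_zero, add_zero]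

theorem SeriesClass.prolong_mem (𝒞 : SeriesClass) {r : ℕ}
    (jet : MultiIdx N (r + 1) × Fin N' → ℂ) {b : Fin N → BiSeries N}
    (hb : ∀ i, b i ∈ 𝒞.carrier _) {Φ : MvPowerSeries (ExtJetVars N N' r) ℂ}
    (hΦ : Φ ∈ 𝒞.carrier _) : prolong jet b Φ ∈ 𝒞.carrier _ := by
  refine sum_mem fun i _ => mul_mem
    (𝒞.rename_mem (Function.Embedding.inl.trans Function.Embedding.inl) (hb i)) ?_
  refine add_mem (𝒞.rename_mem _ (𝒞.pderiv_mem _ hΦ)) (sum_mem fun p _ =>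
    mul_mem (𝒞.rename_mem _ (𝒞.pderiv_mem _ hΦ)) (add_mem (𝒞.X_mem _) ?_))
  exact Subalgebra.algebraMap_mem _ _

/-- The inclusion of the variables `(Z', ζ')`, where `ζ'` is regarded as a `0`-jet. -/
def ExtJetVars.ofTarget (N N' r : ℕ) : Fin N' ⊕ Fin N' ↪ ExtJetVars N N' r :=
  ⟨Sum.elim Sum.inr fun j => Sum.inl (Sum.inr (⟨0, by simp⟩, j)), by
    rintro (i | i) (j | j) h <;> simp_all⟩

theorem FormalMap.extJetTuple_comp_ofTarget (r : ℕ) (H : FormalMap N N') :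
    H.extJetTuple r ∘ ExtJetVars.ofTarget N N' r = H.pair := by
  funext v
  rcases v with v | v
  · rfl
  · change inZeta (multiDeriv 0 (bar (H.comp v))) -
      C (constantCoeff (multiDeriv 0 (bar (H.comp v)))) = inZeta (bar (H.comp v))
    simp [multiDeriv_zero, constantCoeff_bar, H.map_zero]

/-- The iterated derivatives `L_1 ⋯ L_r ρ'(H(Z), H̄(ζ))` are universal expressions in `H(Z)` and in
the derivatives of `H̄(ζ)` of order at most `r`. -/
theorem exists_universal_vf01List (𝒞 : SeriesClass) {Q : Fin N → Fin N → BiSeries N}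
    (hQ : ∀ a i, Q a i ∈ 𝒞.carrier _) {ρ : BiSeries N'} (hρ : ρ ∈ 𝒞.carrier _)
    (H : FormalMap N N') (w : List (Fin N)) {r : ℕ} (hr : w.length ≤ r) :
    ∃ Φ ∈ 𝒞.carrier (ExtJetVars N N' r), ∀ H' : FormalMap N N', H'.jet r = H.jet r →
      vf01List (w.map Q) (H'.pullback ρ) = Φ.subst (H'.extJetTuple r) ∧
      ∀ i, vf01List (w.map Q) (H'.pullback (gradZ ρ i)) =
        (pderiv ℂ (Sum.inr i) Φ).subst (H'.extJetTuple r) := by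
  induction w generalizing r with
  | nil =>
    refine ⟨rename (ExtJetVars.ofTarget N N' r) ρ, 𝒞.rename_mem _ hρ, fun H' _ => ?_⟩
    have hs := H'.hasSubst_extJetTuple r
    have h : ∀ g, H'.pullback g =
        (rename (ExtJetVars.ofTarget N N' r) g).subst (H'.extJetTuple r) := fun g => by
      rw [subst_rename _ hs, H'.extJetTuple_comp_ofTarget]
      rfl
    refine ⟨h ρ, fun i => ?_⟩
    have h' : pderiv ℂ (Sum.inr i) (rename (ExtJetVars.ofTarget N N' r) ρ) =
        rename (ExtJetVars.ofTarget N N' r) (gradZ ρ i) :=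
      pderiv_rename (ExtJetVars.ofTarget N N' r) (Sum.inl i) ρ
    rw [h', ← h]
    rfl
  | cons a w ih =>
    obtain _ | r := r
    · simp at hr
    obtain ⟨Φ, hΦ, hΦH⟩ := ih (r := r) (by simpa using hr)
    -- Only the jet of `H` enters, so the same series serves every `H'` with that jet.
    refine ⟨prolong (H.jet (r + 1)) (Q a) Φ, 𝒞.prolong_mem _ (hQ a) hΦ, fun H' hH' => ?_⟩
    obtain ⟨h₁, h₂⟩ := hΦH H' (by
      funext p
      exact congrFun hH' (p.1.castSucc, p.2))
    refine ⟨?_, fun i => ?_⟩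
    · rw [← hH', subst_prolong, ← h₁]
      rfl
    · rw [pderiv_inr_prolong, ← hH', subst_prolong, ← h₂]
      rfl

end Prolongation

end FormalCR

end

/-! ### The system of equations for `H(Z)` and its solution. -/

noncomputable section

namespace FormalCR

open MvPowerSeries

section BasicIdentity

variable {N N' d d' : ℕ}

theorem FormalMap.IsNondegenerate.exists_degSpace_eq_top {H : FormalMap N N'}
    {M : FormalGenericSubmanifold N d} {M' : FormalGenericSubmanifold N' d'} {k : ℕ}
    (hH : H.IsNondegenerate M M' k) :
    ∃ ρ' : Fin d' → BiSeries N', M'.IsGenerators ρ' ∧ degSpace M H ρ' k = ⊤ := by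
  obtain ⟨ρ', hρ', -, hrank⟩ := hH
  refine ⟨ρ', hρ', Submodule.eq_top_of_finrank_eq ?_⟩
  rw [Module.finrank_fin_fun]
  simpa using hrank

theorem vf01List_mem {M : FormalGenericSubmanifold N d} {Ls : List (Fin N → BiSeries N)}
    (hLs : ∀ L ∈ Ls, M.IsCRVectorField L) {f : BiSeries N} (hf : f ∈ M.ideal) :
    vf01List Ls f ∈ M.ideal := by
  induction Ls with
  | nil => exact hf
  | cons L Ls ih => exact hLs L (by simp) _ (ih fun L' hL' => hLs L' (by simp [hL']))

/-- The gradients with respect to `Z'` at the origin of the series `Φ(Z, ζ, W, Z')` of a given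
class that vanish on `M` when a map from `M` to `M'` with the `k`-jet of `H` is inserted. -/
def equationGradients (𝒞 : SeriesClass) (M : FormalGenericSubmanifold N d)
    (M' : FormalGenericSubmanifold N' d') (H : FormalMap N N') (k : ℕ) :
    Submodule ℂ (Fin N' → ℂ) where
  carrier := {v | ∃ Φ ∈ 𝒞.carrier (ExtJetVars N N' k),
    (∀ H' : FormalMap N N', H'.MapsInto M M' → H'.jet k = H.jet k →
      Φ.subst (H'.extJetTuple k) ∈ M.ideal) ∧
    ∀ i, constantCoeff (pderiv ℂ (Sum.inr i) Φ) = v i}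
  add_mem' := by
    rintro v w ⟨Φ, hΦ, hΦM, hΦv⟩ ⟨Θ, hΘ, hΘM, hΘw⟩
    refine ⟨Φ + Θ, add_mem hΦ hΘ, fun H' hH' hj => ?_, fun i => ?_⟩
    · rw [subst_add (H'.hasSubst_extJetTuple k)]
      exact add_mem (hΦM H' hH' hj) (hΘM H' hH' hj)
    · rw [map_add, map_add, hΦv, hΘw, Pi.add_apply]
  zero_mem' := by
    refine ⟨0, zero_mem _, fun H' _ _ => ?_, fun i => by simp⟩
    rw [subst_zero (H'.hasSubst_extJetTuple k)]
    exact zero_mem _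
  smul_mem' := by
    rintro c v ⟨Φ, hΦ, hΦM, hΦv⟩
    refine ⟨C c * Φ, mul_mem (Subalgebra.algebraMap_mem _ c) hΦ, fun H' hH' hj => ?_, fun i => ?_⟩
    · rw [subst_mul (H'.hasSubst_extJetTuple k)]
      exact Ideal.mul_mem_left _ _ (hΦM H' hH' hj)
    · simp [Derivation.leibniz, hΦv]

/-- Iterated derivatives of the `ρ'` along the frame are such equations, and their gradients take
the values that span `E_k(0)`, which is everything by nondegeneracy. -/
theorem equationGradients_eq_top (𝒞 : SeriesClass) {M : FormalGenericSubmanifold N d}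
    {M' : FormalGenericSubmanifold N' d'} {H : FormalMap N N'} {k : ℕ} (hH : H.MapsInto M M')
    (hnd : H.IsNondegenerate M M' k) {ρ : Fin d → BiSeries N} (hρ : M.IsGenerators ρ)
    (hρ𝒞 : ∀ j, ρ j ∈ 𝒞.carrier _) {ρ' : Fin d' → BiSeries N'} (hρ' : M'.IsGenerators ρ')
    (hρ'𝒞 : ∀ j, ρ' j ∈ 𝒞.carrier _) : equationGradients 𝒞 M M' H k = ⊤ := by
  obtain ⟨ρ₁, hρ₁, htop⟩ := hnd.exists_degSpace_eq_top
  obtain ⟨Q, hQ𝒞, hQ, hspan⟩ := M.exists_frame 𝒞 hρ hρ𝒞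
  rw [eq_top_iff, ← htop]
  rintro _ ⟨v, hv, rfl⟩
  have hv' := degSubmodule_le_frameSubmodule hH hspan hρ₁ hρ' k hv
  -- A submodule over the whole series ring, because a coefficient series acts on values at the
  -- origin through its constant term.
  let T : Submodule (BiSeries N) (Fin N' → BiSeries N) :=
    { carrier := {v | evalZero N' v ∈ equationGradients 𝒞 M M' H k}
      add_mem' := fun {a b} ha hb => by
        rw [Set.mem_ofPred, map_add]
        exact add_mem ha hb
      zero_mem' := by
        rw [Set.mem_ofPred, map_zero]
        exact zero_mem _
      smul_mem' := fun c a ha => by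
        have h : evalZero N' (c • a) = constantCoeff c • evalZero N' a := by
          funext i
          exact map_mul constantCoeff c (a i)
        rw [Set.mem_ofPred, h]
        exact Submodule.smul_mem _ _ ha }
  have hT : frameSubmodule M H Q ρ' k ≤ T := by
    refine sup_le (Submodule.span_le.mpr ?_) ?_
    · rintro _ ⟨w, hw, j, rfl⟩
      obtain ⟨Φ, hΦ, hΦH⟩ := exists_universal_vf01List 𝒞 hQ𝒞 (hρ'𝒞 j) H w hw
      refine ⟨Φ, hΦ, fun H' hH' hj => ?_, fun i => ?_⟩
      · rw [← (hΦH H' hj).1]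
        refine vf01List_mem ?_ (hH' _ (hρ' ▸ Ideal.subset_span ⟨j, rfl⟩))
        intro L hL
        obtain ⟨a, -, rfl⟩ := List.mem_map.mp hL
        exact hQ a
      · rw [← constantCoeff_subst_of_constantCoeff_zero (H.hasSubst_extJetTuple k)
          (H.constantCoeff_extJetTuple k), ← (hΦH H rfl).2 i]
        rfl
    · intro v hv
      have h : evalZero N' v = 0 := by
        funext i
        exact M.constantCoeff_eq_zero (hv i trivial)
      change evalZero N' v ∈ equationGradients 𝒞 M M' H k
      rw [h]
      exact zero_mem _
  exact hT hv'

/-- If `h` solves the fixed point equation `y = F(x, y)` modulo an ideal, then it is congruent to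
the solution of this equation. -/
theorem sub_subst_fixedPoint_mem {σ τ ρ : Type*} [Finite σ] [Finite τ]
    {F : τ → MvPowerSeries (σ ⊕ τ) ℂ}
    (hF' : ∀ i j, constantCoeff (pderiv ℂ (Sum.inr j) (F i)) = 0) {Ψ : τ → MvPowerSeries σ ℂ}
    (hΨ₀ : ∀ i, constantCoeff (Ψ i) = 0) (hΨ : substRight F Ψ = Ψ) {I : Ideal (MvPowerSeries ρ ℂ)}
    {x : σ → MvPowerSeries ρ ℂ} (hx : ∀ i, constantCoeff (x i) = 0) {h : τ → MvPowerSeries ρ ℂ}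
    (hh : ∀ i, constantCoeff (h i) = 0) (hI : ∀ i, h i - (F i).subst (Sum.elim x h) ∈ I) (i : τ) :
    h i - (Ψ i).subst x ∈ I := by
  have := Fintype.ofFinite τ
  have hxs := hasSubst_of_constantCoeff_zero hx
  let y : τ → MvPowerSeries ρ ℂ := fun i => (Ψ i).subst x
  have hy : ∀ i, constantCoeff (y i) = 0 := fun i => by
    rw [constantCoeff_subst_of_constantCoeff_zero hxs hx, hΨ₀]
  have hyF : ∀ i, y i = (F i).subst (Sum.elim x y) := fun i => by
    change (Ψ i).subst x = _
    conv_lhs => rw [← congrFun hΨ i]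
    rw [substRight, subst_comp_subst_apply (hasSubst_sumElim_X hΨ₀) hxs]
    congr 1
    funext j
    rcases j with j | j
    · exact subst_X hxs j
    · rfl
  let J : Ideal (MvPowerSeries ρ ℂ) := Ideal.span (Set.range fun i => h i - y i)
  have hJ : ∀ i, h i - y i ∈ J := fun i => Ideal.subset_span ⟨i, rfl⟩
  suffices J ≤ I from this (hJ i)
  -- Nakayama's lemma, applied to `J ≤ I + 𝔪 J` with `J` finitely generated and `𝔪` the series
  -- without constant term.
  refine Submodule.le_of_le_smul_of_le_jacobson_bot
    (I := RingHom.ker (constantCoeff (σ := ρ) (R := ℂ))) ?_ ?_ ?_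
  · exact Submodule.fg_span (Set.finite_range _)
  · rw [IsLocalRing.jacobson_eq_maximalIdeal _ bot_ne_top]
    intro f hf
    rw [IsLocalRing.mem_maximalIdeal, mem_nonunits_iff, MvPowerSeries.isUnit_iff_constantCoeff,
      show constantCoeff f = 0 from hf]
    exact not_isUnit_zero
  · refine Ideal.span_le.mpr ?_
    rintro _ ⟨i, rfl⟩
    obtain ⟨g, hg₀, hg⟩ := exists_subst_sumElim_sub_eq_sum (hF' i) hx hh hy
    -- The first term is in `I` by assumption; the second is `F(x, h) - F(x, y)`, in `𝔪 J` because
    -- `F` has no linear part in `y`.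
    have hsplit : h i - y i = (h i - (F i).subst (Sum.elim x h)) + ∑ j, (h j - y j) * g j := by
      rw [← hg, ← hyF i]
      ring
    change h i - y i ∈ _
    rw [hsplit]
    refine add_mem (Submodule.mem_sup_left (hI i)) (Submodule.mem_sup_right
      (sum_mem fun j _ => ?_))
    rw [mul_comm]
    exact Submodule.smul_mem_smul (hg₀ j) (hJ j)

/-- The Basic Identity for a nondegenerate map, for submanifolds with generators in a given class
of power series. -/
theorem exists_basicIdentity (𝒞 : SeriesClass) {M : FormalGenericSubmanifold N d}
    {M' : FormalGenericSubmanifold N' d'} {H : FormalMap N N'} {k : ℕ} (hH : H.MapsInto M M')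
    (hnd : H.IsNondegenerate M M' k) {ρ : Fin d → BiSeries N} (hρ : M.IsGenerators ρ)
    (hρ𝒞 : ∀ j, ρ j ∈ 𝒞.carrier _) {ρ' : Fin d' → BiSeries N'} (hρ' : M'.IsGenerators ρ')
    (hρ'𝒞 : ∀ j, ρ' j ∈ 𝒞.carrier _) :
    ∃ Ψ : Fin N' → MvPowerSeries (JetVars N N' k) ℂ, (∀ j, Ψ j ∈ 𝒞.carrier _) ∧
      ∀ H' : FormalMap N N', H'.MapsInto M M' → H'.jet k = H.jet k → BasicIdentity M k Ψ H' := by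
  classical
  have hex : ∀ j : Fin N', Pi.single j 1 ∈ equationGradients 𝒞 M M' H k := fun j => by
    rw [equationGradients_eq_top 𝒞 hH hnd hρ hρ𝒞 hρ' hρ'𝒞]
    trivial
  choose Φ hΦ hΦM hΦ' using hex
  -- The `Z'`-Jacobian of `Φ` at the origin is the identity, so `F` has no linear part in `Z'`.
  let F : Fin N' → MvPowerSeries (ExtJetVars N N' k) ℂ := fun j => X (Sum.inr j) - Φ j
  have hF : ∀ j, constantCoeff (F j) = 0 := fun j => by
    have h := M.constantCoeff_eq_zero (hΦM j H hH rfl)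
    rw [constantCoeff_subst_of_constantCoeff_zero (H.hasSubst_extJetTuple k)
      (H.constantCoeff_extJetTuple k)] at h
    simp [F, h]
  have hF' : ∀ i j, constantCoeff (pderiv ℂ (Sum.inr j) (F i)) = 0 := fun i j => by
    rw [map_sub, map_sub, hΦ', sub_eq_zero]
    rcases eq_or_ne i j with rfl | h
    · simp
    · rw [pderiv_X_of_ne (by simpa using h), Pi.single_eq_of_ne h.symm, map_zero]
  obtain ⟨Ψ, hΨ₀, hΨ, -⟩ := exists_fixedPoint_substRight hF hF'
  refine ⟨Ψ, 𝒞.implicit_mem hF hF' (fun j => sub_mem (𝒞.X_mem _) (hΦ j)) hΨ₀ hΨ,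
    fun H' hH' hj => ?_⟩
  refine sub_subst_fixedPoint_mem hF' hΨ₀ hΨ (H'.constantCoeff_jetTuple k)
    (fun j => by simp [inZ, H'.map_zero]) fun j => ?_
  have hs := H'.hasSubst_extJetTuple k
  have h : (F j).subst (H'.extJetTuple k) =
      inZ (H'.comp j) - (Φ j).subst (H'.extJetTuple k) := by
    rw [subst_sub hs, subst_X hs]
    rfl
  change inZ (H'.comp j) - (F j).subst (H'.extJetTuple k) ∈ M.ideal
  rw [h, sub_sub_cancel]
  exact hΦM j H' hH' hj

theorem FormalGenericSubmanifold.exists_isGenerators (M : FormalGenericSubmanifold N d) :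
    ∃ ρ, M.IsGenerators ρ :=
  M.exists_generators.imp fun _ h => h.1

/-- A single `Ψ` has to satisfy all the claims, so it is built in the smallest class that applies;
algebraic series converge by definition. -/
theorem exists_basicIdentity_of_isNondegenerate {M : FormalGenericSubmanifold N d}
    {M' : FormalGenericSubmanifold N' d'} {H : FormalMap N N'} {k : ℕ} (hH : H.MapsInto M M')
    (hnd : H.IsNondegenerate M M' k) :
    ∃ Ψ : Fin N' → MvPowerSeries (JetVars N N' k) ℂ,
      (∀ H' : FormalMap N N', H'.MapsInto M M' → H'.jet k = H.jet k → BasicIdentity M k Ψ H') ∧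
      (M.IsRealAnalytic → M'.IsRealAnalytic → ∀ j, IsConvergent (Ψ j)) ∧
      (M.IsAlgebraicSubmanifold → M'.IsAlgebraicSubmanifold → ∀ j, IsAlgebraicSeries (Ψ j)) := by
  by_cases halg : M.IsAlgebraicSubmanifold ∧ M'.IsAlgebraicSubmanifold
  · obtain ⟨⟨ρ, hρ, hρ𝒞⟩, ρ', hρ', hρ'𝒞⟩ := halg
    obtain ⟨Ψ, hΨ, hid⟩ := exists_basicIdentity .algebraic hH hnd hρ hρ𝒞 hρ' hρ'𝒞
    exact ⟨Ψ, hid, fun _ _ j => (hΨ j).1, fun _ _ => hΨ⟩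
  by_cases hana : M.IsRealAnalytic ∧ M'.IsRealAnalytic
  · obtain ⟨⟨ρ, hρ, hρ𝒞⟩, ρ', hρ', hρ'𝒞⟩ := hana
    obtain ⟨Ψ, hΨ, hid⟩ := exists_basicIdentity .convergent hH hnd hρ hρ𝒞 hρ' hρ'𝒞
    exact ⟨Ψ, hid, fun _ _ => hΨ, fun h h' => absurd ⟨h, h'⟩ halg⟩
  · obtain ⟨ρ, hρ⟩ := M.exists_isGenerators
    obtain ⟨ρ', hρ'⟩ := M'.exists_isGenerators
    obtain ⟨Ψ, -, hid⟩ := exists_basicIdentity .formal hH hnd hρ (fun _ => trivial) hρ'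
      fun _ => trivial
    exact ⟨Ψ, hid, fun h h' => absurd ⟨h, h'⟩ hana, fun h h' => absurd ⟨h, h'⟩ halg⟩

end BasicIdentity

end FormalCR

end

theorem propositionP {N N' d d' : ℕ}
    (M : FormalCR.FormalGenericSubmanifold N d) (M' : FormalCR.FormalGenericSubmanifold N' d')
    (k₀ : ℕ) :
    ∃ Ψ : (FormalCR.MultiIdx N k₀ × Fin N' → ℂ) →
        Fin N' → MvPowerSeries (FormalCR.JetVars N N' k₀) ℂ,
      ∀ H : FormalCR.FormalMap N N', H.MapsInto M M' → H.IsNondegenerate M M' k₀ →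
        FormalCR.BasicIdentity M k₀ (Ψ (H.jet k₀)) H ∧
        (∀ H' : FormalCR.FormalMap N N', H'.MapsInto M M' → H'.jet k₀ = H.jet k₀ →
          FormalCR.BasicIdentity M k₀ (Ψ (H.jet k₀)) H') ∧
        (M.IsRealAnalytic → M'.IsRealAnalytic →
          ∀ j, FormalCR.IsConvergent (Ψ (H.jet k₀) j)) ∧
        (M.IsAlgebraicSubmanifold → M'.IsAlgebraicSubmanifold →
          ∀ j, FormalCR.IsAlgebraicSeries (Ψ (H.jet k₀) j)) := by
  -- Choosing `Ψ` for each jet `Λ`, not for each map, makes it depend on the jet only: any one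
  -- nondegenerate map with this jet supplies it.
  have key : ∀ Λ : FormalCR.MultiIdx N k₀ × Fin N' → ℂ,
      ∃ Ψ : Fin N' → MvPowerSeries (FormalCR.JetVars N N' k₀) ℂ,
        ∀ H : FormalCR.FormalMap N N', H.MapsInto M M' → H.IsNondegenerate M M' k₀ →
          H.jet k₀ = Λ →
          (∀ H' : FormalCR.FormalMap N N', H'.MapsInto M M' → H'.jet k₀ = Λ →
            FormalCR.BasicIdentity M k₀ Ψ H') ∧
          (M.IsRealAnalytic → M'.IsRealAnalytic → ∀ j, FormalCR.IsConvergent (Ψ j)) ∧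
          (M.IsAlgebraicSubmanifold → M'.IsAlgebraicSubmanifold →
            ∀ j, FormalCR.IsAlgebraicSeries (Ψ j)) := by
    intro Λ
    by_cases h : ∃ H : FormalCR.FormalMap N N',
        H.MapsInto M M' ∧ H.IsNondegenerate M M' k₀ ∧ H.jet k₀ = Λ
    · obtain ⟨H, hH, hnd, rfl⟩ := h
      obtain ⟨Ψ, hΨ⟩ := FormalCR.exists_basicIdentity_of_isNondegenerate hH hnd
      exact ⟨Ψ, fun _ _ _ _ => hΨ⟩
    -- A default value for the jets that no nondegenerate map attains.
    · exact ⟨0, fun H hH hnd hj => absurd ⟨H, hH, hnd, hj⟩ h⟩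
  choose Ψ hΨ using key
  refine ⟨Ψ, fun H hH hnd => ?_⟩
  obtain ⟨h₁, h₂⟩ := hΨ _ H hH hnd rfl
  exact ⟨h₁ H hH rfl, h₁, h₂⟩
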